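/- **Conventions.** Let $\Pi:[0,\infty)\to(0,\infty)$ be a growth function in the following sense: $\Pi$ is non-decreasing; $\Pi$ is doubling, i.e. $\Pi(2p)\le c\,\Pi(p)$ for all $p\ge 0$ and some constant $c$; and $\sum_{j\ge N}2^{-j}\Pi(j)\le c'\,2^{-N}\Pi(N)$ for all integers $N\ge 0$ and some constant $c'$. Its Yudovich function is $y_\Pi(r):=\inf_{p>1}\Pi(p)\,r^{1/p}$, $r>0$. Let $\dot{\mathcal S}(\mathbb R^2)$ be the space of Schwartz functions $\psi$ with $D^\alpha\widehat\psi(0)=0$ for every multi-index $\alpha$ (with the topology of $\mathcal S(\mathbb R^2)$), and let $\dot{\mathcal S}'(\mathbb R^2)$ be its dual, that is, tempered distributions modulo polynomials. Fix a smooth radial function $\varphi:\mathbb R^2\to\mathbb R$ with support in $\{3/4<|\xi|<7/4\}$, $\varphi=1$ for $7/8<|\xi|<9/8$, and $\sum_{j\in\mathbb Z}\varphi(2^{-j}\xi)=1$ for all $\xi\ne0$, and put $\widehat{\dot\Delta_jf}(\xi)=\varphi(2^{-j}\xi)\widehat f(\xi)$ for $f\in\dot{\mathcal S}'(\mathbb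 R^2)$. Define $$\|f\|_{\dot B_\Pi}:=\sup_{N\ge0}\frac1{\Pi(N)}\sum_{j=-\infty}^{N}\|\dot\Delta_jf\|_{L^\infty},\qquad \|f\|_{\dot B^{-1}_{\infty,1}}:=\sum_{j\in\mathbb Z}2^{-j}\|\dot\Delta_jf\|_{L^\infty},$$ and $\|f\|_{\dot B_\Pi\cap\dot B^{-1}_{\infty,1}}:=\max\{\|f\|_{\dot B_\Pi},\|f\|_{\dot B^{-1}_{\infty,1}}\}$. For $\omega\in\dot{\mathcal S}'(\mathbb R^2)$, a velocity of $\omega$ is a bounded continuous vector field $v$ on $\mathbb R^2$ that satisfies the Biot–Savart law $v=\nabla^\perp\Delta^{-1}\omega$ in $\dot{\mathcal S}'(\mathbb R^2)$, where $\nabla^\perp=(-\partial_2,\partial_1)$ and $\nabla^\perp\Delta^{-1}$ is understood as a Fourier multiplier. (Distributions, and hence velocities, may be complex-valued.) **Theorem 1.5.** For every such $\varphi$ and $\Pi$ there is a constant $C>0$, depending only on $\varphi$ and $\Pi$, such that every $\omega\in\dot B_\Pi(\mathbb R^2)\cap\dot B^{-1}_{\infty,1}(\mathbb R^2)$ has a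 velocity, which can be taken real-valued if $\omega$ is real, and every velocity $v$ of $\omega$ satisfies $$|v(x)-v(y)|\le C\,|x-y|\;y_\Pi\Big(\frac1{|x-y|}\Big)\,\|\omega\|_{\dot B_\Pi(\mathbb R^2)\cap\dot B^{-1}_{\infty,1}(\mathbb R^2)}\qquad\text{for all }x,y\in\mathbb R^2,\ x\neq y.$$ -/

import Mathlib

open scoped SchwartzMap FourierTransform ENNReal

noncomputable section

/-- The space `ℝ^d` with its Euclidean norm. -/
abbrev Rd (d : ℕ) : Type := EuclideanSpace ℝ (Fin d)

/-! ### Growth functions and Yudovich functions -/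

/-- The growth class with parameter `κ`: functions `Θ : [0, ∞) → (0, ∞)` that are non-decreasing,
doubling, and satisfy `∑_{j ≥ N} 2^{-jκ} Θ(j) ≲ 2^{-Nκ} Θ(N)` for all integers `N ≥ 0`.
(Values of `Θ` at negative arguments play no role.) -/
structure IsGrowthFunction (κ : ℝ) (Θ : ℝ → ℝ) : Prop where
  pos : ∀ p : ℝ, 0 ≤ p → 0 < Θ p
  mono : ∀ p q : ℝ, 0 ≤ p → p ≤ q → Θ p ≤ Θ q
  doubling : ∃ c : ℝ, ∀ p : ℝ, 0 ≤ p → Θ (2 * p) ≤ c * Θ p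
  summable : Summable fun j : ℕ => (2 : ℝ) ^ (-((j : ℝ) * κ)) * Θ j
  tail : ∃ c : ℝ, ∀ N : ℕ,
    ∑' j : ℕ, (2 : ℝ) ^ (-(((N + j : ℕ) : ℝ) * κ)) * Θ ((N + j : ℕ) : ℝ)
      ≤ c * ((2 : ℝ) ^ (-((N : ℝ) * κ)) * Θ N)

/-- The Yudovich function `y_Θ(r) = inf_{p > 1} Θ(p) r^{1/p}`. -/
def yudovich (Θ : ℝ → ℝ) (r : ℝ) : ℝ :=
  ⨅ p : Set.Ioi (1 : ℝ), Θ p * r ^ (1 / (p : ℝ))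

/-! ### Test functions with vanishing moments, and distributions modulo polynomials -/

/-- The space of Schwartz functions all of whose Fourier-side derivatives vanish at the origin. -/
def schwartzDot (d : ℕ) : Submodule ℂ 𝓢(Rd d, ℂ) where
  carrier := {ψ | ∀ n : ℕ, iteratedFDeriv ℝ n (⇑(𝓕 ψ : 𝓢(Rd d, ℂ))) 0 = 0}
  zero_mem' := by
    intro n
    have h : (𝓕 (0 : 𝓢(Rd d, ℂ)) : 𝓢(Rd d, ℂ)) = 0 :=
      map_zero (FourierTransform.fourierCLM ℂ 𝓢(Rd d, ℂ))
    rw [h]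
    have h0 : (⇑(0 : 𝓢(Rd d, ℂ)) : Rd d → ℂ) = fun _ => 0 := rfl
    rw [h0, iteratedFDeriv_fun_zero]
    rfl
  add_mem' := by
    intro a b ha hb n
    have h0 : (⇑(𝓕 (a + b) : 𝓢(Rd d, ℂ)) : Rd d → ℂ)
        = ⇑(𝓕 a : 𝓢(Rd d, ℂ)) + ⇑(𝓕 b : 𝓢(Rd d, ℂ)) := by
      rw [FourierTransform.fourier_add]; rfl
    rw [h0, iteratedFDeriv_add_apply ((𝓕 a : 𝓢(Rd d, ℂ)).smooth n).contDiffAt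
      ((𝓕 b : 𝓢(Rd d, ℂ)).smooth n).contDiffAt, ha n, hb n, add_zero]
  smul_mem' := by
    intro c a ha n
    have h0 : (⇑(𝓕 (c • a) : 𝓢(Rd d, ℂ)) : Rd d → ℂ) = c • ⇑(𝓕 a : 𝓢(Rd d, ℂ)) := by
      rw [FourierTransform.fourier_smul]; rfl
    rw [h0, iteratedFDeriv_const_smul_apply ((𝓕 a : 𝓢(Rd d, ℂ)).smooth n).contDiffAt, ha n,
      smul_zero]

/-- The dual of `schwartzDot d`, i.e. tempered distributions modulo polynomials. -/
abbrev DistDot (d : ℕ) : Type := schwartzDot d →L[ℂ] ℂ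

/-- A distribution is real if it takes real values on real-valued test functions. -/
def DistDot.IsReal {d : ℕ} (f : DistDot d) : Prop :=
  ∀ ψ : schwartzDot d, (∀ x, ((ψ : 𝓢(Rd d, ℂ)) x).im = 0) → (f ψ).im = 0

/-! ### Littlewood–Paley blocks -/

/-- Generators of the homogeneous Littlewood–Paley decomposition: smooth radial functions supported
in the open annulus `3/4 < |ξ| < 7/4`, equal to `1` for `7/8 < |ξ| < 9/8`, whose dyadic dilates sum
to `1` away from the origin. -/
structure IsLPGenerator {d : ℕ} (φ : Rd d → ℝ) : Prop where
  smooth : ContDiff ℝ (⊤ : ℕ∞) φ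
  radial : ∀ ξ η : Rd d, ‖ξ‖ = ‖η‖ → φ ξ = φ η
  supp : tsupport φ ⊆ {ξ | 3 / 4 < ‖ξ‖ ∧ ‖ξ‖ < 7 / 4}
  eq_one : ∀ ξ : Rd d, 7 / 8 < ‖ξ‖ → ‖ξ‖ < 9 / 8 → φ ξ = 1
  partition : ∀ ξ : Rd d, ξ ≠ 0 → HasSum (fun j : ℤ => φ ((2 : ℝ) ^ (-j) • ξ)) 1

/-- The function `ξ ↦ φ(2^{-j} ξ) e^{-2πi x·ξ}`. -/
def lpSymbol {d : ℕ} (φ : Rd d → ℝ) (j : ℤ) (x ξ : Rd d) : ℂ :=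
  (φ ((2 : ℝ) ^ (-j) • ξ) : ℂ) *
    Complex.exp (((-2 * Real.pi * inner ℝ x ξ : ℝ) : ℂ) * Complex.I)

theorem lpSymbol_contDiff {d : ℕ} {φ : Rd d → ℝ} (hφ : IsLPGenerator φ) (j : ℤ) (x : Rd d) :
    ContDiff ℝ (⊤ : ℕ∞) (lpSymbol φ j x) := by
  unfold lpSymbol
  refine ContDiff.mul ?_ ?_
  · exact Complex.ofRealCLM.contDiff.comp (hφ.smooth.comp (contDiff_id.const_smul _))
  · refine ContDiff.cexp (ContDiff.mul ?_ contDiff_const)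
    exact Complex.ofRealCLM.contDiff.comp
      (contDiff_const.mul (contDiff_const.inner ℝ contDiff_id))

theorem lpSymbol_hasCompactSupport {d : ℕ} {φ : Rd d → ℝ} (hφ : IsLPGenerator φ) (j : ℤ)
    (x : Rd d) : HasCompactSupport (lpSymbol φ j x) := by
  have h1 : HasCompactSupport φ := by
    refine HasCompactSupport.of_support_subset_isCompact
      (isCompact_closedBall (0 : Rd d) (7 / 4)) ?_
    intro ξ hξ
    have := hφ.supp (subset_tsupport _ hξ)
    simpa using this.2.le
  have h2 : HasCompactSupport fun ξ : Rd d => φ ((2 : ℝ) ^ (-j) • ξ) :=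
    h1.comp_smul (zpow_ne_zero _ two_ne_zero)
  have h3 : HasCompactSupport fun ξ : Rd d => (φ ((2 : ℝ) ^ (-j) • ξ) : ℂ) :=
    h2.comp_left (g := fun t : ℝ => (t : ℂ)) Complex.ofReal_zero
  exact h3.mul_right

theorem lpSymbol_eventually_zero {d : ℕ} {φ : Rd d → ℝ} (hφ : IsLPGenerator φ) (j : ℤ)
    (x : Rd d) : lpSymbol φ j x =ᶠ[nhds 0] fun _ => 0 := by
  have h0 : (0 : Rd d) ∉ tsupport φ := by
    intro h
    have := (hφ.supp h).1
    rw [norm_zero] at this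
    norm_num at this
  have h1 : φ =ᶠ[nhds ((2 : ℝ) ^ (-j) • (0 : Rd d))] 0 := by
    rw [smul_zero]
    exact notMem_tsupport_iff_eventuallyEq.mp h0
  have hc : Filter.Tendsto (fun ξ : Rd d => (2 : ℝ) ^ (-j) • ξ) (nhds 0)
      (nhds ((2 : ℝ) ^ (-j) • (0 : Rd d))) :=
    (continuous_const_smul _).tendsto _
  filter_upwards [hc.eventually h1] with ξ hξ
  have h4 : φ ((2 : ℝ) ^ (-j) • ξ) = 0 := hξ
  rw [lpSymbol, h4]
  simp

/-- The function `y ↦ (𝓕⁻¹ φ(2^{-j} ·))(x - y)`, as a Schwartz function of `y` (the function `φ`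
being even, it is the inverse Fourier transform of `φ(2^{-j} ξ) e^{-2πi x·ξ}`). -/
def lpKernelSchwartz {d : ℕ} {φ : Rd d → ℝ} (hφ : IsLPGenerator φ) (j : ℤ) (x : Rd d) :
    𝓢(Rd d, ℂ) :=
  𝓕⁻ ((lpSymbol_hasCompactSupport hφ j x).toSchwartzMap (lpSymbol_contDiff hφ j x))

/-- The same function, as an element of the space `schwartzDot d`. -/
def lpKernel {d : ℕ} {φ : Rd d → ℝ} (hφ : IsLPGenerator φ) (j : ℤ) (x : Rd d) :
    schwartzDot d :=
  ⟨lpKernelSchwartz hφ j x, by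
    intro n
    have h : (𝓕 (lpKernelSchwartz hφ j x) : 𝓢(Rd d, ℂ))
        = (lpSymbol_hasCompactSupport hφ j x).toSchwartzMap (lpSymbol_contDiff hφ j x) :=
      FourierTransform.fourier_fourierInv_eq _
    have h2 : (⇑(𝓕 (lpKernelSchwartz hφ j x) : 𝓢(Rd d, ℂ)) : Rd d → ℂ) = lpSymbol φ j x := by
      rw [h]; rfl
    rw [h2, ((lpSymbol_eventually_zero hφ j x).iteratedFDeriv ℝ n).eq_of_nhds,
      iteratedFDeriv_fun_zero]
    rfl⟩

/-- The dyadic block `Δ̇_j f`, i.e. the Fourier multiplier with symbol `φ(2^{-j} ξ)` applied to `f`.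
It is the smooth function `x ↦ ⟨f, (𝓕⁻¹ φ(2^{-j} ·))(x - ·)⟩`. -/
def lpBlock {d : ℕ} {φ : Rd d → ℝ} (hφ : IsLPGenerator φ) (j : ℤ) (f : DistDot d) (x : Rd d) :
    ℂ :=
  f (lpKernel hφ j x)

/-- The `L^∞` norm of a dyadic block, which is a supremum since the block is continuous. -/
def lpBlockNorm {d : ℕ} {φ : Rd d → ℝ} (hφ : IsLPGenerator φ) (j : ℤ) (f : DistDot d) : ℝ≥0∞ :=
  ⨆ x : Rd d, ‖lpBlock hφ j f x‖ₑ

/-- The norm of the homogeneous Besov space `Ḃ^s_{∞,1}`:  `∑_{j ∈ ℤ} 2^{js} ‖Δ̇_j f‖_∞`. -/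
def besovNorm {d : ℕ} {φ : Rd d → ℝ} (hφ : IsLPGenerator φ) (s : ℝ) (f : DistDot d) : ℝ≥0∞ :=
  ∑' j : ℤ, ENNReal.ofReal ((2 : ℝ) ^ ((j : ℝ) * s)) * lpBlockNorm hφ j f

/-- The norm of the homogeneous Vishik space `Ḃ^s_Θ`:
`sup_{N ≥ 0} Θ(N)⁻¹ ∑_{j ≤ N} 2^{js} ‖Δ̇_j f‖_∞`. -/
def vishikNorm {d : ℕ} {φ : Rd d → ℝ} (hφ : IsLPGenerator φ) (Θ : ℝ → ℝ) (s : ℝ)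
    (f : DistDot d) : ℝ≥0∞ :=
  ⨆ N : ℕ, ENNReal.ofReal ((Θ N)⁻¹) *
    ∑' j : Set.Iic (N : ℤ), ENNReal.ofReal ((2 : ℝ) ^ (((j : ℤ) : ℝ) * s)) * lpBlockNorm hφ j f

/-! ### The Biot–Savart law in the plane -/

/-- `ξ^⊥ = (-ξ₂, ξ₁)`. -/
def perp (ξ : Rd 2) : Rd 2 := !₂[-ξ 1, ξ 0]

/-- The `l`-th component of the symbol of the Biot–Savart operator `∇^⊥ Δ⁻¹`. In the normalization
`𝓕 f ξ = ∫ f(x) e^{-2πi x·ξ} dx` the symbol of `∇^⊥` is `2πi ξ^⊥`, that of `Δ` is `-4π²|ξ|²`. -/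
def biotSavartSymbol (l : Fin 2) (ξ : Rd 2) : ℂ :=
  (2 * Real.pi * Complex.I * (perp ξ l : ℂ)) / (-(4 * Real.pi ^ 2 * ‖ξ‖ ^ 2 : ℝ) : ℂ)

/-- `v = ∇^⊥ Δ⁻¹ ω` as distributions modulo polynomials. The Fourier multiplier with symbol `m` acts
on distributions by duality, its transpose being the multiplier with symbol `m(-ξ)`, which is well
defined on test functions whose Fourier transform vanishes to infinite order at the origin. Thus
`⟨v_l, ψ⟩ = ⟨ω, η⟩` for each test function `ψ`, with `η` its image under the transpose. -/
def BiotSavartLaw (ω : DistDot 2) (v : Rd 2 → EuclideanSpace ℂ (Fin 2)) : Prop :=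
  ∀ (l : Fin 2) (ψ η : schwartzDot 2),
    (∀ ξ : Rd 2, (𝓕 (η : 𝓢(Rd 2, ℂ)) : 𝓢(Rd 2, ℂ)) ξ
      = biotSavartSymbol l (-ξ) * (𝓕 (ψ : 𝓢(Rd 2, ℂ)) : 𝓢(Rd 2, ℂ)) ξ) →
    ∫ x : Rd 2, v x l * (ψ : 𝓢(Rd 2, ℂ)) x = ω η

/-- `v` is a velocity field of the vorticity `ω`: a bounded continuous field satisfying the
Biot–Savart law. Boundedness removes the ambiguity of non-constant polynomials. -/
structure IsVelocity (ω : DistDot 2) (v : Rd 2 → EuclideanSpace ℂ (Fin 2)) : Prop where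
  continuous : Continuous v
  bounded : ∃ M : ℝ, ∀ x, ‖v x‖ ≤ M
  law : BiotSavartLaw ω v

end

open scoped SchwartzMap FourierTransform ENNReal

noncomputable section

open MeasureTheory Filter Topology

/-! The Biot–Savart symbol is smooth off the origin and homogeneous of degree -1, so all its
frequency-localized kernels are translates and dilates of one Schwartz function per component. Hence
the increment between `x` and `y` of the velocity block at frequency `2^j` is at most a constant
times `min (2^{-j}, δ)`, with `δ = |x - y|`, times the norms of three neighbouring vorticity blocks
(`IsLPGenerator.exists_bsTest_bounds`).

It remains to sum over `j` (`IsGrowthFunction.exists_tsum_min_le`). For `δ ≥ 1` the `Ḃ^{-1}_{∞,1}`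
norm alone suffices. For `δ < 1` choose `N` with `2^N ≤ 1/δ < 2^{N+1}`: the blocks `j ≤ N`
contribute `δ Π(N)` by the definition of the Vishik norm, and the others contribute a multiple of
`2^{-N} Π(N)` by the tail condition on `Π`. Finally `Π(N)` is dominated by `y_Π(1/δ)`: doubling only
allows polynomial growth, so passing from `Π(p)` to `Π(N)` costs a power of `N/p`, which is absorbed
by `2^{N/p} ≤ (1/δ)^{1/p}` (`IsGrowthFunction.exists_le_yudovich`).

Distributions enter in three ways. A functional commutes with superpositions of modulated test
functions (`DistDot.apply_mul_fourier`), which turns sup bounds on blocks into bounds by `L¹` norms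
of test functions. The Littlewood–Paley series of a test function converges in `schwartzDot`
(`IsLPGenerator.hasSum_lpMul_fourier`), so the sum of the velocity blocks obeys the Biot–Savart law,
which gives existence. An arbitrary velocity is recovered up to a constant from its blocks by
telescoping low-frequency truncations (`norm_sub_le_tsum_of_blocks`); boundedness makes the
increments of these truncations vanish as the frequency tends to zero. -/

/-! ### Test functions prescribed by their Fourier transform -/

/-- Smooth compactly supported functions vanishing near the origin. -/
structure IsAnnular {d : ℕ} (h : Rd d → ℂ) : Prop where
  smooth : ContDiff ℝ (⊤ : ℕ∞) h
  compact : HasCompactSupport h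
  zero : h =ᶠ[𝓝 0] fun _ => 0

namespace IsAnnular

variable {d : ℕ} {h g : Rd d → ℂ}

/-- A singularity of `g` at the origin is harmless because `h` vanishes in a neighbourhood of it.
This admits the Biot–Savart symbol as a factor. -/
theorem mul_smoothOn (hh : IsAnnular h) (hg : ContDiffOn ℝ (⊤ : ℕ∞) g {0}ᶜ) :
    IsAnnular fun ξ => h ξ * g ξ where
  smooth := by
    rw [contDiff_iff_contDiffAt]
    intro ξ
    by_cases hξ : ξ = 0
    · subst hξ
      refine (contDiffAt_const (c := (0 : ℂ))).congr_of_eventuallyEq ?_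
      filter_upwards [hh.zero] with x hx
      simp [hx]
    · exact hh.smooth.contDiffAt.mul
        ((hg ξ hξ).contDiffAt (isOpen_compl_singleton.mem_nhds hξ))
  compact := hh.compact.mul_right
  zero := by
    filter_upwards [hh.zero] with x hx
    simp [hx]

theorem mul (hh : IsAnnular h) (hg : ContDiff ℝ (⊤ : ℕ∞) g) : IsAnnular fun ξ => h ξ * g ξ :=
  hh.mul_smoothOn hg.contDiffOn

theorem add (hh : IsAnnular h) (hg : IsAnnular g) : IsAnnular fun ξ => h ξ + g ξ where
  smooth := hh.smooth.add hg.smooth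
  compact := hh.compact.add hg.compact
  zero := by
    filter_upwards [hh.zero, hg.zero] with x hx hy
    simp [hx, hy]

theorem sum {ι : Type*} {s : Finset ι} {f : ι → Rd d → ℂ} (hf : ∀ i ∈ s, IsAnnular (f i)) :
    IsAnnular fun ξ => ∑ i ∈ s, f i ξ := by
  classical
  induction s using Finset.induction_on with
  | empty =>
    simp only [Finset.sum_empty]
    exact ⟨contDiff_const, HasCompactSupport.zero, Eventually.of_forall fun _ => rfl⟩
  | insert a s ha ih =>
    simp only [Finset.sum_insert ha]
    exact (hf a (Finset.mem_insert_self a s)).add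
      (ih fun i hi => hf i (Finset.mem_insert_of_mem hi))

/-- An annular function as a Schwartz function. -/
def toSchwartz (hh : IsAnnular h) : 𝓢(Rd d, ℂ) := hh.compact.toSchwartzMap hh.smooth

end IsAnnular

variable {d : ℕ}

theorem schwartzDot_ext {ψ η : schwartzDot d}
    (h : ∀ ξ, (𝓕 (ψ : 𝓢(Rd d, ℂ)) : 𝓢(Rd d, ℂ)) ξ = (𝓕 (η : 𝓢(Rd d, ℂ)) : 𝓢(Rd d, ℂ)) ξ) :
    ψ = η := by
  have h1 : (𝓕 (ψ : 𝓢(Rd d, ℂ)) : 𝓢(Rd d, ℂ)) = 𝓕 (η : 𝓢(Rd d, ℂ)) := SchwartzMap.ext h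
  apply Subtype.ext
  rw [← FourierTransform.fourierInv_fourier_eq (F := 𝓢(Rd d, ℂ)) (ψ : 𝓢(Rd d, ℂ)), h1,
    FourierTransform.fourierInv_fourier_eq]

open Classical in
/-- The test function with Fourier transform `h` (zero if `h` is not annular). -/
def ofFourier (h : Rd d → ℂ) : schwartzDot d :=
  if hh : IsAnnular h then
    ⟨𝓕⁻ hh.toSchwartz, by
      intro n
      have h2 : (⇑(𝓕 (𝓕⁻ hh.toSchwartz : 𝓢(Rd d, ℂ)) : 𝓢(Rd d, ℂ)) : Rd d → ℂ) = h := by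
        rw [FourierTransform.fourier_fourierInv_eq]; rfl
      rw [h2, (hh.zero.iteratedFDeriv ℝ n).eq_of_nhds, iteratedFDeriv_fun_zero]
      rfl⟩
  else 0

theorem ofFourier_coe {h : Rd d → ℂ} (hh : IsAnnular h) :
    (ofFourier h : 𝓢(Rd d, ℂ)) = 𝓕⁻ hh.toSchwartz := by
  rw [ofFourier, dif_pos hh]

theorem fourier_ofFourier {h : Rd d → ℂ} (hh : IsAnnular h) (ξ : Rd d) :
    (𝓕 (ofFourier h : 𝓢(Rd d, ℂ)) : 𝓢(Rd d, ℂ)) ξ = h ξ := by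
  rw [ofFourier_coe hh, FourierTransform.fourier_fourierInv_eq]; rfl

theorem ofFourier_apply {h : Rd d → ℂ} (hh : IsAnnular h) (x : Rd d) :
    (ofFourier h : 𝓢(Rd d, ℂ)) x
      = ∫ ξ, Complex.exp (((2 * Real.pi * inner ℝ ξ x : ℝ) : ℂ) * Complex.I) * h ξ := by
  rw [ofFourier_coe hh, SchwartzMap.fourierInv_coe, Real.fourierInv_eq']
  rfl

theorem fourier_add_apply (f g : 𝓢(Rd d, ℂ)) (ξ : Rd d) :
    (𝓕 (f + g) : 𝓢(Rd d, ℂ)) ξ = (𝓕 f : 𝓢(Rd d, ℂ)) ξ + (𝓕 g : 𝓢(Rd d, ℂ)) ξ := by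
  rw [FourierTransform.fourier_add]; rfl

theorem fourier_smul_apply (c : ℂ) (f : 𝓢(Rd d, ℂ)) (ξ : Rd d) :
    (𝓕 (c • f) : 𝓢(Rd d, ℂ)) ξ = c * (𝓕 f : 𝓢(Rd d, ℂ)) ξ := by
  rw [FourierTransform.fourier_smul]; rfl

theorem fourier_sub_apply (f g : 𝓢(Rd d, ℂ)) (ξ : Rd d) :
    (𝓕 (f - g) : 𝓢(Rd d, ℂ)) ξ = (𝓕 f : 𝓢(Rd d, ℂ)) ξ - (𝓕 g : 𝓢(Rd d, ℂ)) ξ := by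
  have : f - g = f + (-1 : ℂ) • g := by simp [sub_eq_add_neg]
  rw [this, fourier_add_apply, fourier_smul_apply]
  ring

theorem ofFourier_add {h g : Rd d → ℂ} (hh : IsAnnular h) (hg : IsAnnular g) :
    ofFourier (fun ξ => h ξ + g ξ) = ofFourier h + ofFourier g := by
  apply schwartzDot_ext
  intro ξ
  rw [fourier_ofFourier (hh.add hg), Submodule.coe_add, fourier_add_apply, fourier_ofFourier hh,
    fourier_ofFourier hg]

theorem ofFourier_smul {h : Rd d → ℂ} (hh : IsAnnular h) (c : ℂ) :
    ofFourier (fun ξ => h ξ * c) = c • ofFourier h := by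
  apply schwartzDot_ext
  intro ξ
  rw [fourier_ofFourier (hh.mul contDiff_const), Submodule.coe_smul, fourier_smul_apply,
    fourier_ofFourier hh, mul_comm]

theorem ofFourier_sum {ι : Type*} {s : Finset ι} {f : ι → Rd d → ℂ}
    (hf : ∀ i, IsAnnular (f i)) :
    ofFourier (fun ξ => ∑ i ∈ s, f i ξ) = ∑ i ∈ s, ofFourier (f i) := by
  classical
  induction s using Finset.induction_on with
  | empty =>
    have := ofFourier_smul (IsAnnular.sum (s := (∅ : Finset ι)) (f := f) (by simp)) 0
    simpa using this
  | insert a s ha ih =>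
    simp only [Finset.sum_insert ha]
    rw [← ih]
    exact ofFourier_add (hf a) (IsAnnular.sum fun i _ => hf i)

/-- The character `ξ ↦ e^{-2πi x·ξ}`. -/
def chr (x ξ : Rd d) : ℂ :=
  Complex.exp (((-2 * Real.pi * inner ℝ x ξ : ℝ) : ℂ) * Complex.I)

theorem contDiff_chr (x : Rd d) : ContDiff ℝ (⊤ : ℕ∞) (chr x) := by
  unfold chr
  refine ContDiff.cexp (ContDiff.mul ?_ contDiff_const)
  exact Complex.ofRealCLM.contDiff.comp
    (contDiff_const.mul (contDiff_const.inner ℝ contDiff_id))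

/-- The dilated generator `ξ ↦ φ(2^{-j} ξ)`, as a complex-valued function. -/
def lpMul (φ : Rd d → ℝ) (j : ℤ) (ξ : Rd d) : ℂ := (φ ((2 : ℝ) ^ (-j) • ξ) : ℂ)

theorem lpSymbol_eq (φ : Rd d → ℝ) (j : ℤ) (x ξ : Rd d) :
    lpSymbol φ j x ξ = lpMul φ j ξ * chr x ξ := rfl

theorem IsLPGenerator.isAnnular_lpSymbol {φ : Rd d → ℝ} (hφ : IsLPGenerator φ) (j : ℤ)
    (x : Rd d) : IsAnnular (lpSymbol φ j x) :=
  ⟨lpSymbol_contDiff hφ j x, lpSymbol_hasCompactSupport hφ j x, lpSymbol_eventually_zero hφ j x⟩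

theorem IsLPGenerator.isAnnular_lpMul {φ : Rd d → ℝ} (hφ : IsLPGenerator φ) (j : ℤ) :
    IsAnnular (lpMul φ j) := by
  have h := hφ.isAnnular_lpSymbol j 0
  have h2 : lpSymbol φ j 0 = lpMul φ j := by
    funext ξ
    simp [lpSymbol, lpMul]
  rwa [h2] at h

theorem lpKernel_eq {φ : Rd d → ℝ} (hφ : IsLPGenerator φ) (j : ℤ) (x : Rd d) :
    lpKernel hφ j x = ofFourier (lpSymbol φ j x) := by
  apply Subtype.ext
  rw [ofFourier_coe (hφ.isAnnular_lpSymbol j x)]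
  rfl

/-- A functional on `schwartzDot d` is bounded by finitely many Schwartz seminorms of the Fourier
transform of the test function. -/
theorem DistDot.exists_bound (T : DistDot d) :
    ∃ (s : Finset (ℕ × ℕ)) (C : ℝ), 0 ≤ C ∧ ∀ ψ : schwartzDot d,
      ‖T ψ‖ ≤ C * ∑ m ∈ s, SchwartzMap.seminorm ℂ m.1 m.2 (𝓕 (ψ : 𝓢(Rd d, ℂ)) : 𝓢(Rd d, ℂ)) := by
  let F : schwartzDot d →ₗ[ℂ] 𝓢(Rd d, ℂ) :=
    (FourierTransform.fourierCLE ℂ 𝓢(Rd d, ℂ)).toLinearMap ∘ₗ (schwartzDot d).subtype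
  have hF : Topology.IsInducing F :=
    (FourierTransform.fourierCLE ℂ 𝓢(Rd d, ℂ)).toHomeomorph.isInducing.comp .subtypeVal
  let p : Seminorm ℂ (schwartzDot d) := (normSeminorm ℂ ℂ).comp T.toLinearMap
  have hp : Continuous p := continuous_norm.comp T.continuous
  obtain ⟨s, C, -, hC⟩ := Seminorm.bound_comp_of_isInducing hp
    (schwartz_withSeminorms ℂ (Rd d) ℂ) hF
  refine ⟨s, C, C.2, fun ψ => ?_⟩
  refine (hC ψ).trans ?_
  have h1 : s.sup (schwartzSeminormFamily ℂ (Rd d) ℂ) (F ψ)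
      ≤ (∑ m ∈ s, schwartzSeminormFamily ℂ (Rd d) ℂ m) (F ψ) :=
    Seminorm.finset_sup_le_sum _ _ _
  have h2 : (∑ m ∈ s, schwartzSeminormFamily ℂ (Rd d) ℂ m) (F ψ)
      = ∑ m ∈ s, SchwartzMap.seminorm ℂ m.1 m.2 (F ψ) := by
    rw [← FunLike.coeAddMonoidHom_apply, map_sum, Finset.sum_apply]
    rfl
  rw [h2] at h1
  exact mul_le_mul_of_nonneg_left h1 C.2

/-! ### Testing against superpositions of translates -/

theorem SchwartzMap.exists_one_add_norm_pow_mul_le {E F : Type*} [NormedAddCommGroup E]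
    [NormedSpace ℝ E] [NormedAddCommGroup F] [NormedSpace ℝ F] (f : 𝓢(E, F)) (m : ℕ) :
    ∃ C : ℝ, 0 ≤ C ∧ ∀ x, (1 + ‖x‖) ^ m * ‖f x‖ ≤ C := by
  have h := fun x => SchwartzMap.one_add_le_sup_seminorm_apply (𝕜 := ℝ) (m := (m, 0)) le_rfl le_rfl
    f x
  simp only [norm_iteratedFDeriv_zero] at h
  exact ⟨_, le_trans (by positivity) (h 0), h⟩

/-- A Schwartz function multiplied by `(1 + ‖x‖)^m`, as a bounded continuous function. -/
def weighted (m : ℕ) : 𝓢(Rd d, ℂ) →ₗ[ℂ] BoundedContinuousFunction (Rd d) ℂ where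
  toFun ψ := BoundedContinuousFunction.ofNormedAddCommGroup
    (fun x => (((1 + ‖x‖) ^ m : ℝ) : ℂ) * ψ x)
    (by have := ψ.continuous; fun_prop) (ψ.exists_one_add_norm_pow_mul_le m).choose (by
      intro x
      rw [norm_mul, Complex.norm_real, Real.norm_of_nonneg (by positivity)]
      exact (ψ.exists_one_add_norm_pow_mul_le m).choose_spec.2 x)
  map_add' f g := by
    ext x
    simp [mul_add]
  map_smul' c f := by
    ext x
    simp only [BoundedContinuousFunction.coe_ofNormedAddCommGroup, _root_.smul_apply,
      smul_eq_mul, RingHom.id_apply, BoundedContinuousFunction.coe_smul]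
    ring

theorem weighted_apply (m : ℕ) (ψ : 𝓢(Rd d, ℂ)) (x : Rd d) :
    weighted m ψ x = (((1 + ‖x‖) ^ m : ℝ) : ℂ) * ψ x := rfl

theorem norm_weighted_apply (m : ℕ) (ψ : 𝓢(Rd d, ℂ)) (x : Rd d) :
    ‖weighted m ψ x‖ = (1 + ‖x‖) ^ m * ‖ψ x‖ := by
  rw [weighted_apply, norm_mul, Complex.norm_real, Real.norm_of_nonneg (by positivity)]

/-- Injectivity lets a functional on Schwartz functions be transported to the range of `weighted m`,
a subspace of a normed space to which Hahn–Banach applies. -/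
theorem weighted_injective (m : ℕ) : Function.Injective (weighted (d := d) m) := by
  intro f g h
  ext x
  have h1 := DFunLike.congr_fun h x
  rw [weighted_apply, weighted_apply] at h1
  refine mul_left_cancel₀ ?_ h1
  exact_mod_cast (by positivity : (0 : ℝ) < (1 + ‖x‖) ^ m).ne'

theorem integrable_one_add_norm_Rd :
    Integrable (fun x : Rd d => (1 + ‖x‖) ^ (-((d : ℝ) + 1))) :=
  integrable_one_add_norm (by simp)

/-- Of the `m` weights, `q` absorb the power of `‖v‖` and `d + 1` pay for integrability over `ℝ^d`.
-/
theorem integral_pow_mul_le_weighted {m q : ℕ} (hq : q + d + 1 ≤ m) (ψ : 𝓢(Rd d, ℂ)) :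
    ∫ v : Rd d, ‖v‖ ^ q * ‖ψ v‖
      ≤ (∫ v : Rd d, (1 + ‖v‖) ^ (-((d : ℝ) + 1))) * ‖weighted m ψ‖ := by
  rw [← integral_mul_const]
  refine integral_mono (ψ.integrable_pow_mul volume q)
    (integrable_one_add_norm_Rd.mul_const _) fun v => ?_
  have h1 : (1 + ‖v‖) ^ m * ‖ψ v‖ ≤ ‖weighted m ψ‖ := by
    rw [← norm_weighted_apply]
    exact (weighted m ψ).norm_coe_le_norm v
  have h0 : (1 : ℝ) ≤ 1 + ‖v‖ := by simp
  have h2 : (1 + ‖v‖) ^ (-((d : ℝ) + 1)) = ((1 + ‖v‖) ^ (d + 1))⁻¹ := by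
    rw [Real.rpow_neg (by positivity)]
    congr 1
    exact_mod_cast Real.rpow_natCast (1 + ‖v‖) (d + 1)
  simp only [h2]
  rw [inv_mul_eq_div, le_div_iff₀ (by positivity)]
  refine le_trans ?_ h1
  calc ‖v‖ ^ q * ‖ψ v‖ * (1 + ‖v‖) ^ (d + 1)
      ≤ (1 + ‖v‖) ^ q * ‖ψ v‖ * (1 + ‖v‖) ^ (d + 1) := by gcongr; linarith
    _ = (1 + ‖v‖) ^ (q + d + 1) * ‖ψ v‖ := by ring
    _ ≤ (1 + ‖v‖) ^ m * ‖ψ v‖ := by gcongr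

/-- Each derivative on the Fourier side costs only a power of the space variable, so no derivative
of `ψ` is needed. -/
theorem norm_iteratedFDeriv_fourier_le_weighted {m k : ℕ} (hk : k + d + 1 ≤ m)
    (ψ : 𝓢(Rd d, ℂ)) (ξ : Rd d) :
    ‖iteratedFDeriv ℝ k (⇑(𝓕 ψ : 𝓢(Rd d, ℂ))) ξ‖
      ≤ (2 * Real.pi) ^ k * (k + 1) * (∫ v : Rd d, (1 + ‖v‖) ^ (-((d : ℝ) + 1)))
        * ‖weighted m ψ‖ := by
  have h := Real.pow_mul_norm_iteratedFDeriv_fourier_le (f := ⇑ψ) (K := k) (N := 0) (k := k)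
    (n := 0)
    (ψ.smooth 0) (fun i n _ _ => ψ.integrable_pow_mul_iteratedFDeriv volume i n) le_rfl le_rfl ξ
  simp only [pow_zero, one_mul, mul_one, zero_add, Finset.range_one, Finset.sum_product,
    Finset.sum_singleton, norm_iteratedFDeriv_zero] at h
  rw [SchwartzMap.fourier_coe]
  refine h.trans ?_
  rw [mul_assoc, mul_assoc]
  refine mul_le_mul_of_nonneg_left ?_ (by positivity)
  calc ∑ q ∈ Finset.range (k + 1), ∫ v : Rd d, ‖v‖ ^ q * ‖ψ v‖
      ≤ ∑ q ∈ Finset.range (k + 1),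
          (∫ v : Rd d, (1 + ‖v‖) ^ (-((d : ℝ) + 1))) * ‖weighted m ψ‖ := by
        refine Finset.sum_le_sum fun q hq => integral_pow_mul_le_weighted ?_ ψ
        have := Finset.mem_range.mp hq
        omega
    _ = _ := by simp

/-- In the Leibniz expansion the growth `‖ξ‖ ^ k` is charged to the fixed cutoff `θ`; the
derivatives of `𝓕 ψ` then need only be bounded. -/
theorem seminorm_mul_fourier_le_weighted (θ : 𝓢(Rd d, ℂ)) {m k n : ℕ} (hn : n + d + 1 ≤ m) :
    ∃ C : ℝ, 0 ≤ C ∧ ∀ ψ f : 𝓢(Rd d, ℂ), (∀ ξ, f ξ = θ ξ * (𝓕 ψ : 𝓢(Rd d, ℂ)) ξ) →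
      SchwartzMap.seminorm ℂ k n f ≤ C * ‖weighted m ψ‖ := by
  set I := ∫ v : Rd d, (1 + ‖v‖) ^ (-((d : ℝ) + 1)) with hI
  have hI0 : 0 ≤ I := integral_nonneg fun v => by positivity
  refine ⟨∑ i ∈ Finset.range (n + 1), (n.choose i : ℝ) * SchwartzMap.seminorm ℂ k i θ *
    ((2 * Real.pi) ^ (n - i) * ((n - i : ℕ) + 1) * I), ?_, fun ψ f hf => ?_⟩
  · exact Finset.sum_nonneg fun i _ => by positivity
  refine SchwartzMap.seminorm_le_bound ℂ k n f ?_ fun ξ => ?_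
  · exact mul_nonneg (Finset.sum_nonneg fun i _ => by positivity) (norm_nonneg _)
  have hf' : (⇑f : Rd d → ℂ) = fun ξ => θ ξ * (𝓕 ψ : 𝓢(Rd d, ℂ)) ξ := funext hf
  rw [hf']
  have h := norm_iteratedFDeriv_mul_le (θ.smooth n) ((𝓕 ψ : 𝓢(Rd d, ℂ)).smooth n) ξ
    (n := n) le_rfl
  refine (mul_le_mul_of_nonneg_left h (by positivity)).trans ?_
  rw [Finset.mul_sum, Finset.sum_mul]
  refine Finset.sum_le_sum fun i hi => ?_
  have h1 := SchwartzMap.le_seminorm ℂ k i θ ξ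
  have h2 := norm_iteratedFDeriv_fourier_le_weighted (m := m) (k := n - i) (by omega) ψ ξ
  calc ‖ξ‖ ^ k * ((n.choose i : ℝ) * ‖iteratedFDeriv ℝ i (⇑θ) ξ‖ *
        ‖iteratedFDeriv ℝ (n - i) (⇑(𝓕 ψ : 𝓢(Rd d, ℂ))) ξ‖)
      = (n.choose i : ℝ) * (‖ξ‖ ^ k * ‖iteratedFDeriv ℝ i (⇑θ) ξ‖) *
        ‖iteratedFDeriv ℝ (n - i) (⇑(𝓕 ψ : 𝓢(Rd d, ℂ))) ξ‖ := by ring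
    _ ≤ (n.choose i : ℝ) * SchwartzMap.seminorm ℂ k i θ * ((2 * Real.pi) ^ (n - i) *
        ((n - i : ℕ) + 1) * I * ‖weighted m ψ‖) := by gcongr
    _ = _ := by ring

/-- After frequency localization a functional no longer sees derivatives of `ψ`: one weighted sup
norm controls it. -/
theorem DistDot.exists_weighted_bound (T : DistDot d) {θ : Rd d → ℂ} (hθ : IsAnnular θ) :
    ∃ (m : ℕ) (C : ℝ), 0 ≤ C ∧ ∀ ψ : 𝓢(Rd d, ℂ),
      ‖T (ofFourier fun ξ => θ ξ * (𝓕 ψ : 𝓢(Rd d, ℂ)) ξ)‖ ≤ C * ‖weighted m ψ‖ := by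
  obtain ⟨s, C, hC0, hC⟩ := T.exists_bound
  have hm : ∀ p ∈ s, p.2 + d + 1 ≤ s.sup Prod.snd + d + 1 := fun p hp => by
    have : p.2 ≤ s.sup Prod.snd := Finset.le_sup (f := Prod.snd) hp
    omega
  have hbd : ∀ p ∈ s, ∃ D : ℝ, 0 ≤ D ∧ ∀ ψ f : 𝓢(Rd d, ℂ),
      (∀ ξ, f ξ = hθ.toSchwartz ξ * (𝓕 ψ : 𝓢(Rd d, ℂ)) ξ) →
      SchwartzMap.seminorm ℂ p.1 p.2 f ≤ D * ‖weighted (s.sup Prod.snd + d + 1) ψ‖ :=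
    fun p hp => seminorm_mul_fourier_le_weighted _ (hm p hp)
  choose! D hD0 hD using hbd
  refine ⟨s.sup Prod.snd + d + 1, C * ∑ p ∈ s, D p,
    mul_nonneg hC0 (Finset.sum_nonneg hD0), fun ψ => (hC _).trans ?_⟩
  rw [mul_assoc, Finset.sum_mul]
  refine mul_le_mul_of_nonneg_left (Finset.sum_le_sum fun p hp => hD p hp ψ _ fun ξ => ?_) hC0
  exact fourier_ofFourier (hθ.mul (SchwartzMap.smooth _ _)) ξ

theorem one_add_norm_le_mul (x z : Rd d) : 1 + ‖x‖ ≤ (1 + ‖x - z‖) * (1 + ‖z‖) := by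
  have h : ‖x‖ ≤ ‖x - z‖ + ‖z‖ := by simpa using norm_add_le (x - z) z
  nlinarith [norm_nonneg (x - z), norm_nonneg z, mul_nonneg (norm_nonneg (x - z)) (norm_nonneg z)]

theorem exists_norm_weighted_translate_le (K : 𝓢(Rd d, ℂ)) (m : ℕ) :
    ∃ C : ℝ, 0 ≤ C ∧ ∀ z : Rd d,
      ‖weighted m (SchwartzMap.compSubConstCLM ℂ z K)‖ ≤ C * (1 + ‖z‖) ^ m := by
  obtain ⟨C, hC0, hC⟩ := K.exists_one_add_norm_pow_mul_le m
  refine ⟨C, hC0, fun z => ?_⟩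
  refine (BoundedContinuousFunction.norm_le (by positivity)).mpr fun x => ?_
  rw [norm_weighted_apply, SchwartzMap.compSubConstCLM_apply]
  calc (1 + ‖x‖) ^ m * ‖K (x - z)‖
      ≤ ((1 + ‖x - z‖) * (1 + ‖z‖)) ^ m * ‖K (x - z)‖ := by
        gcongr; exact one_add_norm_le_mul x z
    _ = (1 + ‖x - z‖) ^ m * ‖K (x - z)‖ * (1 + ‖z‖) ^ m := by rw [mul_pow]; ring
    _ ≤ C * (1 + ‖z‖) ^ m := by gcongr; exact hC _

/-- Mean value inequality on the unit ball about `x - z`. A point `w` of it satisfies `‖x - w‖ ≤ 1 +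
‖z‖`, whence the factor `2 + ‖z‖` when the weight is moved from `x` to `w`. -/
theorem exists_norm_weighted_translate_sub_le (K : 𝓢(Rd d, ℂ)) (m : ℕ) :
    ∃ C : ℝ, 0 ≤ C ∧ ∀ z z' : Rd d, ‖z' - z‖ ≤ 1 →
      ‖weighted m (SchwartzMap.compSubConstCLM ℂ z' K)
        - weighted m (SchwartzMap.compSubConstCLM ℂ z K)‖ ≤ C * (2 + ‖z‖) ^ m * ‖z' - z‖ := by
  obtain ⟨C, hC0, hC⟩ :=
    (SchwartzMap.fderivCLM ℝ (Rd d) ℂ K).exists_one_add_norm_pow_mul_le m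
  refine ⟨C, hC0, fun z z' hz' => ?_⟩
  rw [← map_sub]
  refine (BoundedContinuousFunction.norm_le (by positivity)).mpr fun x => ?_
  rw [norm_weighted_apply]
  have hx : (SchwartzMap.compSubConstCLM ℂ z' K - SchwartzMap.compSubConstCLM ℂ z K) x
      = K (x - z') - K (x - z) := rfl
  rw [hx]
  have hd : ∀ w ∈ Metric.closedBall (x - z) 1,
      ‖fderiv ℝ K w‖ ≤ C * (2 + ‖z‖) ^ m / (1 + ‖x‖) ^ m := by
    intro w hw
    rw [mem_closedBall_iff_norm] at hw
    rw [le_div_iff₀ (by positivity)]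
    have hu : ‖x - w‖ ≤ 1 + ‖z‖ := by
      have : x - w = -(w - (x - z)) + z := by abel
      rw [this]
      refine (norm_add_le _ _).trans ?_
      rw [norm_neg]
      linarith
    have h1 : 1 + ‖x‖ ≤ (1 + ‖w‖) * (2 + ‖z‖) := by
      have := one_add_norm_le_mul x (x - w)
      rw [sub_sub_cancel] at this
      exact this.trans (mul_le_mul_of_nonneg_left (by linarith) (by positivity))
    calc ‖fderiv ℝ K w‖ * (1 + ‖x‖) ^ m
        ≤ ‖fderiv ℝ K w‖ * ((1 + ‖w‖) * (2 + ‖z‖)) ^ m := by gcongr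
      _ = (1 + ‖w‖) ^ m * ‖fderiv ℝ K w‖ * (2 + ‖z‖) ^ m := by rw [mul_pow]; ring
      _ ≤ C * (2 + ‖z‖) ^ m := by gcongr; exact hC w
  have h2 := Convex.norm_image_sub_le_of_norm_fderiv_le (𝕜 := ℝ) (f := ⇑K)
    (x := x - z) (y := x - z') (fun w _ => K.differentiableAt) hd
    (convex_closedBall (x - z) 1) (Metric.mem_closedBall_self zero_le_one) (by
      rw [mem_closedBall_iff_norm]
      have : x - z' - (x - z) = -(z' - z) := by abel
      rwa [this, norm_neg])
  have h3 : ‖x - z' - (x - z)‖ = ‖z' - z‖ := by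
    have : x - z' - (x - z) = -(z' - z) := by abel
    rw [this, norm_neg]
  rw [h3] at h2
  refine (mul_le_mul_of_nonneg_left h2 (by positivity)).trans (le_of_eq ?_)
  field_simp

theorem continuous_weighted_translate (K : 𝓢(Rd d, ℂ)) (m : ℕ) :
    Continuous fun z : Rd d => weighted m (SchwartzMap.compSubConstCLM ℂ z K) := by
  obtain ⟨C, -, key⟩ := exists_norm_weighted_translate_sub_le K m
  rw [continuous_iff_continuousAt]
  intro z
  rw [ContinuousAt, tendsto_iff_norm_sub_tendsto_zero]
  refine squeeze_zero' (Eventually.of_forall fun _ => norm_nonneg _)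
    (g := fun z' => C * (2 + ‖z‖) ^ m * ‖z' - z‖) ?_ ?_
  · filter_upwards [Metric.closedBall_mem_nhds z zero_lt_one] with z' hz'
    exact key z z' (by rwa [mem_closedBall_iff_norm] at hz')
  · have : Continuous fun z' : Rd d => C * (2 + ‖z‖) ^ m * ‖z' - z‖ := by fun_prop
    simpa using this.tendsto z

theorem fourier_translate (K : 𝓢(Rd d, ℂ)) (z ξ : Rd d) :
    (𝓕 (SchwartzMap.compSubConstCLM ℂ z K) : 𝓢(Rd d, ℂ)) ξ
      = (𝓕 K : 𝓢(Rd d, ℂ)) ξ * chr z ξ := by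
  rw [SchwartzMap.fourier_coe, SchwartzMap.fourier_coe, Real.fourier_eq', Real.fourier_eq']
  rw [← integral_add_right_eq_self _ z, ← integral_mul_const]
  refine integral_congr_ae (Eventually.of_forall fun v => ?_)
  simp only [SchwartzMap.compSubConstCLM_apply, add_sub_cancel_right, smul_eq_mul, chr]
  rw [inner_add_left, mul_right_comm (Complex.exp _), ← Complex.exp_add]
  congr 2
  push_cast
  ring

/-- A functional applied to a superposition of modulated annular functions is the superposition of
its values. -/
theorem DistDot.apply_mul_fourier (T : DistDot d) {θ θ₁ : Rd d → ℂ} (hθ : IsAnnular θ)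
    (hθ₁ : IsAnnular θ₁) (G : 𝓢(Rd d, ℂ)) :
    T (ofFourier fun ξ => θ ξ * (θ₁ ξ * (𝓕 G : 𝓢(Rd d, ℂ)) ξ))
      = ∫ z, G z * T (ofFourier fun ξ => θ ξ * (θ₁ ξ * chr z ξ)) := by
  obtain ⟨m, C, hC0, hC⟩ := T.exists_weighted_bound hθ
  let L : 𝓢(Rd d, ℂ) →ₗ[ℂ] ℂ :=
    { toFun := fun ψ => T (ofFourier fun ξ => θ ξ * (𝓕 ψ : 𝓢(Rd d, ℂ)) ξ)
      map_add' := fun f g => by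
        rw [← map_add, ← ofFourier_add (hθ.mul (SchwartzMap.smooth _ _))
          (hθ.mul (SchwartzMap.smooth _ _))]
        congr 2
        funext ξ
        rw [fourier_add_apply, mul_add]
      map_smul' := fun c f => by
        rw [RingHom.id_apply, ← map_smul, ← ofFourier_smul (hθ.mul (SchwartzMap.smooth _ _))]
        congr 2
        funext ξ
        rw [fourier_smul_apply]
        ring }
  -- `L` is bounded for the weighted sup norm alone, so it descends to the range of `weighted m` and
  -- extends by Hahn–Banach to all bounded continuous functions. In that Banach space a continuous
  -- functional commutes with the Bochner integral.
  let e := LinearEquiv.ofInjective (weighted (d := d) m) (weighted_injective m)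
  have he : ∀ ψ : 𝓢(Rd d, ℂ), e.symm ⟨weighted m ψ, LinearMap.mem_range_self _ ψ⟩ = ψ := fun ψ =>
    e.symm_apply_apply ψ
  let f : StrongDual ℂ (LinearMap.range (weighted (d := d) m)) :=
    LinearMap.mkContinuous (L ∘ₗ e.symm.toLinearMap) C (by
      rintro ⟨_, ψ, rfl⟩
      change ‖L (e.symm ⟨weighted m ψ, _⟩)‖ ≤ _
      rw [he]
      exact hC ψ)
  obtain ⟨g, hg, -⟩ := exists_extension_norm_eq _ f
  have hgL : ∀ ψ, g (weighted m ψ) = L ψ := fun ψ => by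
    rw [hg ⟨weighted m ψ, LinearMap.mem_range_self _ ψ⟩]
    change L (e.symm ⟨weighted m ψ, _⟩) = _
    rw [he]
  let K : 𝓢(Rd d, ℂ) := 𝓕⁻ hθ₁.toSchwartz
  have hK : ∀ ξ, (𝓕 K : 𝓢(Rd d, ℂ)) ξ = θ₁ ξ := fun ξ => by
    rw [FourierTransform.fourier_fourierInv_eq]; rfl
  obtain ⟨D, hD0, hD⟩ := exists_norm_weighted_translate_le K m
  let w : Rd d → BoundedContinuousFunction (Rd d) ℂ := fun z =>
    G z • weighted m (SchwartzMap.compSubConstCLM ℂ z K)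
  have hw : Integrable w := by
    have hmaj : Integrable fun z : Rd d => D * (2 : ℝ) ^ m * (‖G z‖ + ‖z‖ ^ m * ‖G z‖) :=
      (G.integrable.norm.add (G.integrable_pow_mul volume m)).const_mul _
    refine hmaj.mono' ?_ (Eventually.of_forall fun z => ?_)
    · exact (G.continuous.smul (continuous_weighted_translate K m)).aestronglyMeasurable
    · rw [norm_smul]
      have h1 : (1 + ‖z‖) ^ m ≤ 2 ^ m * (1 + ‖z‖ ^ m) := by
        rcases le_total ‖z‖ 1 with h | h
        · calc (1 + ‖z‖) ^ m ≤ 2 ^ m := by gcongr; linarith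
            _ ≤ 2 ^ m * (1 + ‖z‖ ^ m) := le_mul_of_one_le_right (by positivity) (by simp)
        · calc (1 + ‖z‖) ^ m ≤ (2 * ‖z‖) ^ m := by gcongr; linarith
            _ = 2 ^ m * ‖z‖ ^ m := mul_pow _ _ _
            _ ≤ 2 ^ m * (1 + ‖z‖ ^ m) := by gcongr; simp
      calc ‖G z‖ * ‖weighted m (SchwartzMap.compSubConstCLM ℂ z K)‖
          ≤ ‖G z‖ * (D * (2 ^ m * (1 + ‖z‖ ^ m))) := by
            gcongr; exact (hD z).trans (by gcongr)
        _ = _ := by ring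
  -- The convolution `G * K` is the superposition of the translates of `K` with density `G`, now as
  -- an integral in the Banach space.
  have hint : weighted m (SchwartzMap.convolution (ContinuousLinearMap.mul ℂ ℂ) G K)
      = ∫ z, w z := by
    ext x
    have h1 : (∫ z, w z) x = ∫ z, w z x :=
      ((BoundedContinuousFunction.evalCLM ℂ x).integral_comp_comm hw).symm
    rw [h1, weighted_apply, SchwartzMap.convolution_apply, MeasureTheory.convolution,
      ← integral_const_mul]
    refine integral_congr_ae (Eventually.of_forall fun z => ?_)
    simp only [w, BoundedContinuousFunction.coe_smul, smul_eq_mul, weighted_apply,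
      SchwartzMap.compSubConstCLM_apply, ContinuousLinearMap.mul_apply']
    ring
  have hleft : L (SchwartzMap.convolution (ContinuousLinearMap.mul ℂ ℂ) G K)
      = T (ofFourier fun ξ => θ ξ * (θ₁ ξ * (𝓕 G : 𝓢(Rd d, ℂ)) ξ)) := by
    change T (ofFourier _) = _
    congr 2
    funext ξ
    rw [SchwartzMap.fourier_convolution, SchwartzMap.pairing_apply_apply,
      ContinuousLinearMap.mul_apply', hK, mul_comm (θ₁ ξ)]
  rw [← hleft, ← hgL, hint, ← g.integral_comp_comm hw]
  refine integral_congr_ae (Eventually.of_forall fun z => ?_)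
  simp only [w, map_smul, smul_eq_mul, hgL]
  congr 1
  change T (ofFourier _) = _
  congr 2
  funext ξ
  rw [fourier_translate, hK]

/-- Translations are Lipschitz continuous in `L¹` on Schwartz functions. -/
theorem SchwartzMap.exists_integral_translate_sub_le (f : 𝓢(Rd d, ℂ)) :
    ∃ C : ℝ, 0 ≤ C ∧ ∀ a b : Rd d, ∫ z, ‖f (z - a) - f (z - b)‖ ≤ C * ‖a - b‖ := by
  obtain ⟨C, hC0, hC⟩ := exists_norm_weighted_translate_sub_le f (d + 1)
  set I := ∫ v : Rd d, (1 + ‖v‖) ^ (-((d : ℝ) + 1)) with hI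
  have hI0 : 0 ≤ I := integral_nonneg fun v => by positivity
  have hN0 : 0 ≤ ∫ z, ‖f z‖ := integral_nonneg fun v => norm_nonneg _
  have htr : ∀ c : Rd d, Integrable fun z => f (z - c) := fun c => f.integrable.comp_sub_right c
  have hA : 0 ≤ I * (C * 2 ^ (d + 1)) := mul_nonneg hI0 (mul_nonneg hC0 (by positivity))
  have h0 : ∀ c : Rd d,
      ∫ z, ‖f (z - c) - f z‖ ≤ (I * (C * 2 ^ (d + 1)) + 2 * ∫ z, ‖f z‖) * ‖c‖ := by
    intro c
    -- Small displacements use the derivative bound; for large ones the triangle inequality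
    -- suffices, since then `1 ≤ ‖c‖`.
    rcases le_total ‖c‖ 1 with hc | hc
    · have h1 := integral_pow_mul_le_weighted (m := d + 1) (q := 0) (by omega)
        (SchwartzMap.compSubConstCLM ℂ c f - SchwartzMap.compSubConstCLM ℂ 0 f)
      have h2 := hC 0 c (by simpa using hc)
      rw [← map_sub] at h2
      simp only [norm_zero, add_zero, sub_zero] at h2
      have h3 : ∀ z, (SchwartzMap.compSubConstCLM ℂ c f - SchwartzMap.compSubConstCLM ℂ 0 f) z
          = f (z - c) - f z := fun z => by
        change f (z - c) - f (z - 0) = _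
        rw [sub_zero]
      simp only [pow_zero, one_mul, h3] at h1
      calc ∫ z, ‖f (z - c) - f z‖ ≤ I * (C * 2 ^ (d + 1) * ‖c‖) := h1.trans (by gcongr)
        _ ≤ _ := by nlinarith [mul_nonneg hN0 (norm_nonneg c)]
    · have hs : Integrable fun z => ‖f (z - c)‖ + ‖f z‖ := (htr c).norm.add f.integrable.norm
      calc ∫ z, ‖f (z - c) - f z‖ ≤ ∫ z, (‖f (z - c)‖ + ‖f z‖) :=
            integral_mono_of_nonneg (Eventually.of_forall fun z => norm_nonneg _) hs
              (Eventually.of_forall fun z => norm_sub_le _ _)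
        _ = 2 * ∫ z, ‖f z‖ := by
            rw [integral_add (htr c).norm f.integrable.norm,
              integral_sub_right_eq_self (fun z => ‖f z‖) c]
            ring
        _ ≤ (2 * ∫ z, ‖f z‖) * ‖c‖ := le_mul_of_one_le_right (mul_nonneg zero_le_two hN0) hc
        _ ≤ _ := mul_le_mul_of_nonneg_right (le_add_of_nonneg_left hA) (norm_nonneg _)
  refine ⟨_, add_nonneg hA (mul_nonneg zero_le_two hN0), fun a b => ?_⟩
  have h1 := h0 (a - b)
  rw [← integral_sub_right_eq_self _ b] at h1
  simpa only [sub_sub, add_sub_cancel] using h1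

/-! ### Littlewood–Paley blocks -/

section LittlewoodPaley

variable {φ : Rd d → ℝ}

theorem norm_two_zpow_smul (j : ℤ) (ξ : Rd d) : ‖(2 : ℝ) ^ (-j) • ξ‖ = ‖ξ‖ / 2 ^ j := by
  rw [norm_smul, Real.norm_of_nonneg (by positivity), zpow_neg, inv_mul_eq_div]

theorem IsLPGenerator.bounds_of_lpMul_ne_zero (hφ : IsLPGenerator φ) {j : ℤ} {ξ : Rd d}
    (h : lpMul φ j ξ ≠ 0) : 3 / 4 * 2 ^ j < ‖ξ‖ ∧ ‖ξ‖ < 7 / 4 * 2 ^ j := by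
  have h1 : φ ((2 : ℝ) ^ (-j) • ξ) ≠ 0 := fun h0 => h (by rw [lpMul, h0]; simp)
  have h2 := hφ.supp (subset_tsupport _ h1)
  simp only [Set.mem_ofPred_eq, norm_two_zpow_smul] at h2
  have hp : (0 : ℝ) < 2 ^ j := by positivity
  exact ⟨(lt_div_iff₀ hp).mp h2.1, (div_lt_iff₀ hp).mp h2.2⟩

theorem IsLPGenerator.hasSum_lpMul (hφ : IsLPGenerator φ) {ξ : Rd d} (hξ : ξ ≠ 0) :
    HasSum (fun j : ℤ => lpMul φ j ξ) 1 := by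
  have := (Complex.hasSum_ofReal (f := fun j : ℤ => φ ((2 : ℝ) ^ (-j) • ξ)) (x := 1)).mpr
    (hφ.partition ξ hξ)
  simpa [lpMul] using this

theorem IsLPGenerator.lpMul_zero (hφ : IsLPGenerator φ) (j : ℤ) : lpMul φ j 0 = 0 :=
  (hφ.isAnnular_lpMul j).zero.eq_of_nhds

/-- The sum of three consecutive dilated generators. -/
def lpFat (φ : Rd d → ℝ) (j : ℤ) (ξ : Rd d) : ℂ :=
  ∑ i ∈ Finset.Icc (-1 : ℤ) 1, lpMul φ (j + i) ξ

theorem IsLPGenerator.isAnnular_lpFat (hφ : IsLPGenerator φ) (j : ℤ) : IsAnnular (lpFat φ j) :=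
  IsAnnular.sum fun i _ => hφ.isAnnular_lpMul (j + i)

/-- The annuli of indices `j` and `j + i` can meet only if `2 ^ |i| < 7/3`, that is `|i| ≤ 1`. So
three consecutive generators already sum to `1` on the support of the middle one. -/
theorem IsLPGenerator.lpMul_mul_lpFat (hφ : IsLPGenerator φ) (j : ℤ) (ξ : Rd d) :
    lpMul φ j ξ * lpFat φ j ξ = lpMul φ j ξ := by
  by_cases h : lpMul φ j ξ = 0
  · rw [h, zero_mul]
  have hb := hφ.bounds_of_lpMul_ne_zero h
  have hξ : ξ ≠ 0 := by
    rintro rfl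
    exact h (hφ.lpMul_zero j)
  have h1 : HasSum (fun i : ℤ => lpMul φ (j + i) ξ) 1 :=
    (Equiv.addLeft j).hasSum_iff.mpr (hφ.hasSum_lpMul hξ)
  have h2 : HasSum (fun i : ℤ => lpMul φ (j + i) ξ) (lpFat φ j ξ) := by
    refine hasSum_sum_of_ne_finset_zero fun i hi => ?_
    by_contra hne
    have hb' := hφ.bounds_of_lpMul_ne_zero hne
    rw [zpow_add₀ two_ne_zero] at hb'
    have hp : (0 : ℝ) < 2 ^ j := by positivity
    apply hi
    rw [Finset.mem_Icc]
    constructor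
    · by_contra hlt
      have : (2 : ℝ) ^ i ≤ 2 ^ (-2 : ℤ) := zpow_le_zpow_right₀ one_le_two (by omega)
      norm_num at this
      nlinarith
    · by_contra hlt
      have : (2 : ℝ) ^ (2 : ℤ) ≤ 2 ^ i := zpow_le_zpow_right₀ one_le_two (by omega)
      norm_num at this
      nlinarith
  rw [h2.unique h1, mul_one]

/-- The supremum norm of a dyadic block as a real number. -/
def blockNorm (hφ : IsLPGenerator φ) (T : DistDot d) (j : ℤ) : ℝ := (lpBlockNorm hφ j T).toReal

theorem blockNorm_nonneg (hφ : IsLPGenerator φ) (T : DistDot d) (j : ℤ) :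
    0 ≤ blockNorm hφ T j := ENNReal.toReal_nonneg

theorem norm_apply_lpSymbol_le (hφ : IsLPGenerator φ) {T : DistDot d}
    (hT : ∀ j, lpBlockNorm hφ j T ≠ ⊤) (j : ℤ) (x : Rd d) :
    ‖T (ofFourier (lpSymbol φ j x))‖ ≤ blockNorm hφ T j := by
  rw [← lpKernel_eq hφ, blockNorm, ← ENNReal.ofReal_le_iff_le_toReal (hT j), ofReal_norm]
  exact le_iSup (fun x => ‖lpBlock hφ j T x‖ₑ) x

/-- The test function is a superposition, with density `G`, of the kernels that define the values of
the `j`-th block; `lpFat` only supplies the second cutoff required by `DistDot.apply_mul_fourier`.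
-/
theorem norm_apply_lpMul_mul_fourier_le (hφ : IsLPGenerator φ) {T : DistDot d}
    (hT : ∀ j, lpBlockNorm hφ j T ≠ ⊤) (j : ℤ) (G : 𝓢(Rd d, ℂ)) :
    ‖T (ofFourier fun ξ => lpMul φ j ξ * (𝓕 G : 𝓢(Rd d, ℂ)) ξ)‖
      ≤ blockNorm hφ T j * ∫ z, ‖G z‖ := by
  have h := T.apply_mul_fourier (hφ.isAnnular_lpMul j) (hφ.isAnnular_lpFat j) G
  simp only [← mul_assoc, hφ.lpMul_mul_lpFat, ← lpSymbol_eq] at h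
  rw [h, mul_comm, ← integral_mul_const]
  refine norm_integral_le_of_norm_le (G.integrable.norm.mul_const _)
    (Eventually.of_forall fun z => ?_)
  rw [norm_mul]
  exact mul_le_mul_of_nonneg_left (norm_apply_lpSymbol_le hφ hT j z) (norm_nonneg _)

/-- Bernstein-type bound: a functional tested against a function localized at frequency `2^j`. -/
theorem norm_apply_le_of_localized (hφ : IsLPGenerator φ) {T : DistDot d}
    (hT : ∀ j, lpBlockNorm hφ j T ≠ ⊤) (j : ℤ) {ψ : schwartzDot d}
    (hψ : ∀ ξ, (𝓕 (ψ : 𝓢(Rd d, ℂ)) : 𝓢(Rd d, ℂ)) ξ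
      = lpFat φ j ξ * (𝓕 (ψ : 𝓢(Rd d, ℂ)) : 𝓢(Rd d, ℂ)) ξ) :
    ‖T ψ‖ ≤ (∑ i ∈ Finset.Icc (-1 : ℤ) 1, blockNorm hφ T (j + i))
      * ∫ z, ‖(ψ : 𝓢(Rd d, ℂ)) z‖ := by
  have hann : ∀ i : ℤ, IsAnnular fun ξ =>
      lpMul φ (j + i) ξ * (𝓕 (ψ : 𝓢(Rd d, ℂ)) : 𝓢(Rd d, ℂ)) ξ := fun i =>
    (hφ.isAnnular_lpMul (j + i)).mul (SchwartzMap.smooth _ _)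
  have h1 : ψ = ∑ i ∈ Finset.Icc (-1 : ℤ) 1, ofFourier fun ξ =>
      lpMul φ (j + i) ξ * (𝓕 (ψ : 𝓢(Rd d, ℂ)) : 𝓢(Rd d, ℂ)) ξ := by
    rw [← ofFourier_sum hann]
    apply schwartzDot_ext
    intro ξ
    rw [fourier_ofFourier (IsAnnular.sum fun i _ => hann i), ← Finset.sum_mul]
    exact hψ ξ
  conv_lhs => rw [h1]
  rw [map_sum, Finset.sum_mul]
  exact (norm_sum_le _ _).trans (Finset.sum_le_sum fun i _ =>
    norm_apply_lpMul_mul_fourier_le hφ hT (j + i) _)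

end LittlewoodPaley

/-! ### Localized Biot–Savart kernels -/

section BiotSavart

variable {φ : Rd 2 → ℝ}

theorem perp_smul_apply (t : ℝ) (ξ : Rd 2) (l : Fin 2) : perp (t • ξ) l = t * perp ξ l := by
  fin_cases l <;> simp [perp]

theorem biotSavartSymbol_smul {t : ℝ} (ht : t ≠ 0) (l : Fin 2) (ξ : Rd 2) :
    biotSavartSymbol l (t • ξ) = (t : ℂ)⁻¹ * biotSavartSymbol l ξ := by
  have h2 : ‖t • ξ‖ ^ 2 = t ^ 2 * ‖ξ‖ ^ 2 := by
    rw [norm_smul, mul_pow, Real.norm_eq_abs, sq_abs]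
  have ht' : (t : ℂ) ≠ 0 := by exact_mod_cast ht
  rw [biotSavartSymbol, biotSavartSymbol, perp_smul_apply, h2]
  push_cast
  -- At the origin both sides are `0`, by the convention for division by zero.
  by_cases hξ : (‖ξ‖ : ℂ) = 0
  · simp [hξ]
  · field_simp

theorem biotSavartSymbol_neg (l : Fin 2) (ξ : Rd 2) :
    biotSavartSymbol l (-ξ) = -biotSavartSymbol l ξ := by
  have := biotSavartSymbol_smul (t := -1) (by norm_num) l ξ
  rw [neg_one_smul] at this
  rw [this]
  norm_num

/-- Hermitian symmetry of the symbol makes the localized kernels real, which later yields a real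
velocity for real vorticity. -/
theorem conj_biotSavartSymbol (l : Fin 2) (ξ : Rd 2) :
    (starRingEnd ℂ) (biotSavartSymbol l ξ) = biotSavartSymbol l (-ξ) := by
  rw [biotSavartSymbol_neg]
  simp only [biotSavartSymbol, map_div₀, map_mul, map_neg, Complex.conj_ofReal, Complex.conj_I,
    map_ofNat]
  ring

theorem contDiffOn_biotSavartSymbol (l : Fin 2) :
    ContDiffOn ℝ (⊤ : ℕ∞) (fun ξ : Rd 2 => biotSavartSymbol l (-ξ)) {0}ᶜ := by
  simp only [biotSavartSymbol_neg]
  suffices h : ContDiffOn ℝ (⊤ : ℕ∞) (fun ξ : Rd 2 => biotSavartSymbol l ξ) {0}ᶜ from h.neg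
  simp only [biotSavartSymbol, div_eq_mul_inv]
  refine ContDiffOn.mul ?_ (ContDiffOn.inv (𝕜' := ℂ) ?_ ?_)
  · refine contDiffOn_const.mul (Complex.ofRealCLM.contDiff.comp_contDiffOn
      (g := fun t : ℝ => (t : ℂ)) (f := fun ξ : Rd 2 => perp ξ l) ?_)
    have h0 : ∀ i : Fin 2, ContDiff ℝ (⊤ : ℕ∞) fun ξ : Rd 2 => ξ i := fun i =>
      contDiff_euclidean.mp contDiff_id i
    fin_cases l
    · simpa [perp] using (h0 1).neg.contDiffOn
    · simpa [perp] using (h0 0).contDiffOn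
  · refine (Complex.ofRealCLM.contDiff.comp_contDiffOn (g := fun t : ℝ => (t : ℂ))
      (f := fun ξ : Rd 2 => 4 * Real.pi ^ 2 * ‖ξ‖ ^ 2) ?_).neg
    exact (contDiff_const.mul (contDiff_norm_sq ℝ)).contDiffOn
  · intro ξ hξ
    have : (0 : ℝ) < 4 * Real.pi ^ 2 * ‖ξ‖ ^ 2 := by
      have := norm_pos_iff.mpr hξ
      positivity
    rw [neg_ne_zero]
    exact_mod_cast this.ne'

/-- The symbol of the transpose of the localized Biot–Savart operator. -/
def bsMul (φ : Rd 2 → ℝ) (j : ℤ) (l : Fin 2) (ξ : Rd 2) : ℂ :=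
  lpMul φ j ξ * biotSavartSymbol l (-ξ)

theorem IsLPGenerator.isAnnular_bsMul (hφ : IsLPGenerator φ) (j : ℤ) (l : Fin 2) :
    IsAnnular (bsMul φ j l) :=
  (hφ.isAnnular_lpMul j).mul_smoothOn (contDiffOn_biotSavartSymbol l)

theorem IsLPGenerator.isAnnular_bsMul_chr (hφ : IsLPGenerator φ) (j : ℤ) (l : Fin 2)
    (x : Rd 2) : IsAnnular fun ξ => bsMul φ j l ξ * chr x ξ :=
  (hφ.isAnnular_bsMul j l).mul (contDiff_chr x)

/-- The kernel at `x` of the transpose of the localized Biot–Savart operator. -/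
def bsTest (φ : Rd 2 → ℝ) (j : ℤ) (l : Fin 2) (x : Rd 2) : schwartzDot 2 :=
  ofFourier fun ξ => bsMul φ j l ξ * chr x ξ

theorem IsLPGenerator.fourier_bsTest (hφ : IsLPGenerator φ) (j : ℤ) (l : Fin 2) (x ξ : Rd 2) :
    (𝓕 (bsTest φ j l x : 𝓢(Rd 2, ℂ)) : 𝓢(Rd 2, ℂ)) ξ = bsMul φ j l ξ * chr x ξ :=
  fourier_ofFourier (hφ.isAnnular_bsMul_chr j l x) ξ

/-- Dilating the frequency variable gives the Jacobian `2^{2j}`, and homogeneity of degree -1 takes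
back one factor `2^j`. -/
theorem IsLPGenerator.bsTest_apply (hφ : IsLPGenerator φ) (j : ℤ) (l : Fin 2) (x z : Rd 2) :
    (bsTest φ j l x : 𝓢(Rd 2, ℂ)) z
      = (2 : ℂ) ^ j * (bsTest φ 0 l 0 : 𝓢(Rd 2, ℂ)) ((2 : ℝ) ^ j • (z - x)) := by
  rw [bsTest, bsTest, ofFourier_apply (hφ.isAnnular_bsMul_chr j l x),
    ofFourier_apply (hφ.isAnnular_bsMul_chr 0 l 0)]
  have hR : (0 : ℝ) < 2 ^ j := by positivity
  have hc := Measure.integral_comp_smul (volume : Measure (Rd 2)) (fun ξ : Rd 2 =>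
    Complex.exp (((2 * Real.pi * inner ℝ ξ z : ℝ) : ℂ) * Complex.I)
      * (bsMul φ j l ξ * chr x ξ)) ((2 : ℝ) ^ j)
  simp only [finrank_euclideanSpace, Fintype.card_fin] at hc
  rw [abs_of_pos (by positivity), eq_inv_smul_iff₀ (by positivity)] at hc
  rw [← hc, ← integral_const_mul, ← integral_smul]
  refine integral_congr_ae (Eventually.of_forall fun ζ => ?_)
  have h1 : lpMul φ j ((2 : ℝ) ^ j • ζ) = lpMul φ 0 ζ := by
    rw [lpMul, lpMul, smul_smul, ← zpow_add₀ two_ne_zero]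
    simp
  have h2 : chr (0 : Rd 2) ζ = 1 := by simp [chr]
  have h3 : biotSavartSymbol l (-((2 : ℝ) ^ j • ζ))
      = ((2 : ℂ) ^ j)⁻¹ * biotSavartSymbol l (-ζ) := by
    rw [← smul_neg, biotSavartSymbol_smul hR.ne']
    push_cast
    rfl
  have h4 : Complex.exp (((2 * Real.pi * inner ℝ ζ ((2 : ℝ) ^ j • (z - x)) : ℝ) : ℂ) * Complex.I)
      = Complex.exp (((2 * Real.pi * inner ℝ ((2 : ℝ) ^ j • ζ) z : ℝ) : ℂ) * Complex.I)
        * chr x ((2 : ℝ) ^ j • ζ) := by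
    rw [chr, ← Complex.exp_add, ← add_mul]
    congr 2
    rw [inner_smul_right, inner_sub_right, inner_smul_left, inner_smul_right,
      real_inner_comm x ζ]
    simp only [conj_trivial]
    push_cast
    ring
  have hc2 : (2 : ℂ) ^ j ≠ 0 := zpow_ne_zero _ two_ne_zero
  simp only [bsMul, h1, h2, h3, h4, Complex.real_smul]
  push_cast
  field_simp

/-- The amplitude `2^j` against the planar change of variables `2^{-2j}` leaves `2^{-j}`. -/
theorem IsLPGenerator.exists_integral_bsTest_le (hφ : IsLPGenerator φ) (l : Fin 2) :
    ∃ C : ℝ, 0 ≤ C ∧ ∀ (j : ℤ) (x : Rd 2),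
      ∫ z, ‖(bsTest φ j l x : 𝓢(Rd 2, ℂ)) z‖ ≤ C * ((2 : ℝ) ^ j)⁻¹ := by
  refine ⟨∫ z, ‖(bsTest φ 0 l 0 : 𝓢(Rd 2, ℂ)) z‖, integral_nonneg fun _ => norm_nonneg _,
    fun j x => le_of_eq ?_⟩
  have hR : (0 : ℝ) < 2 ^ j := by positivity
  simp only [hφ.bsTest_apply j l x, norm_mul, norm_zpow, Complex.norm_ofNat]
  rw [integral_const_mul, integral_sub_right_eq_self
    (fun z => ‖(bsTest φ 0 l 0 : 𝓢(Rd 2, ℂ)) ((2 : ℝ) ^ j • z)‖) x,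
    Measure.integral_comp_smul volume (fun z => ‖(bsTest φ 0 l 0 : 𝓢(Rd 2, ℂ)) z‖)]
  simp only [finrank_euclideanSpace, Fintype.card_fin, smul_eq_mul]
  rw [abs_of_pos (by positivity)]
  field_simp

/-- Rescaling to unit frequency turns the displacement into `2^j (x - y)`; this cancels the gain
`2^{-j}` exactly, so the bound is uniform in `j`. -/
theorem IsLPGenerator.exists_integral_bsTest_sub_le (hφ : IsLPGenerator φ) (l : Fin 2) :
    ∃ C : ℝ, 0 ≤ C ∧ ∀ (j : ℤ) (x y : Rd 2),
      ∫ z, ‖(bsTest φ j l x - bsTest φ j l y : schwartzDot 2).1 z‖ ≤ C * ‖x - y‖ := by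
  obtain ⟨C, hC0, hC⟩ :=
    SchwartzMap.exists_integral_translate_sub_le (bsTest φ 0 l 0 : 𝓢(Rd 2, ℂ))
  refine ⟨C, hC0, fun j x y => ?_⟩
  have hR : (0 : ℝ) < 2 ^ j := by positivity
  have h1 : ∀ z, (bsTest φ j l x - bsTest φ j l y : schwartzDot 2).1 z
      = (2 : ℂ) ^ j * ((bsTest φ 0 l 0 : 𝓢(Rd 2, ℂ)) ((2 : ℝ) ^ j • z - (2 : ℝ) ^ j • x)
        - (bsTest φ 0 l 0 : 𝓢(Rd 2, ℂ)) ((2 : ℝ) ^ j • z - (2 : ℝ) ^ j • y)) := by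
    intro z
    change (bsTest φ j l x : 𝓢(Rd 2, ℂ)) z - (bsTest φ j l y : 𝓢(Rd 2, ℂ)) z = _
    rw [hφ.bsTest_apply j l x, hφ.bsTest_apply j l y, ← mul_sub, smul_sub, smul_sub]
  simp only [h1, norm_mul, norm_zpow, Complex.norm_ofNat]
  rw [integral_const_mul, Measure.integral_comp_smul volume
    (fun z => ‖(bsTest φ 0 l 0 : 𝓢(Rd 2, ℂ)) (z - (2 : ℝ) ^ j • x)
      - (bsTest φ 0 l 0 : 𝓢(Rd 2, ℂ)) (z - (2 : ℝ) ^ j • y)‖)]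
  simp only [finrank_euclideanSpace, Fintype.card_fin, smul_eq_mul]
  rw [abs_of_pos (by positivity)]
  have h2 := hC ((2 : ℝ) ^ j • x) ((2 : ℝ) ^ j • y)
  rw [← smul_sub, norm_smul, Real.norm_of_nonneg hR.le] at h2
  refine (mul_le_mul_of_nonneg_left (mul_le_mul_of_nonneg_left h2 (by positivity)) hR.le).trans
    (le_of_eq ?_)
  field_simp

/-- The blocks of the velocity are controlled by the blocks of the vorticity. -/
theorem IsLPGenerator.exists_bsTest_bounds (hφ : IsLPGenerator φ) :
    ∃ C : ℝ, 0 ≤ C ∧ ∀ T : DistDot 2, (∀ j, lpBlockNorm hφ j T ≠ ⊤) → ∀ (j : ℤ) (l : Fin 2),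
      (∀ x, ‖T (bsTest φ j l x)‖
        ≤ C * ((2 : ℝ) ^ j)⁻¹ * ∑ i ∈ Finset.Icc (-1 : ℤ) 1, blockNorm hφ T (j + i)) ∧
      ∀ x y, ‖T (bsTest φ j l x) - T (bsTest φ j l y)‖
        ≤ C * ‖x - y‖ * ∑ i ∈ Finset.Icc (-1 : ℤ) 1, blockNorm hφ T (j + i) := by
  choose A hA0 hA using hφ.exists_integral_bsTest_le
  choose B hB0 hB using hφ.exists_integral_bsTest_sub_le
  have hAC : ∀ l, A l ≤ ∑ l, (A l + B l) := fun l =>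
    (le_add_of_nonneg_right (hB0 l)).trans (Finset.single_le_sum (f := fun l => A l + B l)
      (fun i _ => add_nonneg (hA0 i) (hB0 i)) (Finset.mem_univ l))
  have hBC : ∀ l, B l ≤ ∑ l, (A l + B l) := fun l =>
    (le_add_of_nonneg_left (hA0 l)).trans (Finset.single_le_sum (f := fun l => A l + B l)
      (fun i _ => add_nonneg (hA0 i) (hB0 i)) (Finset.mem_univ l))
  have hloc : ∀ j l x ξ, (𝓕 (bsTest φ j l x : 𝓢(Rd 2, ℂ)) : 𝓢(Rd 2, ℂ)) ξ
      = lpFat φ j ξ * (𝓕 (bsTest φ j l x : 𝓢(Rd 2, ℂ)) : 𝓢(Rd 2, ℂ)) ξ := by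
    intro j l x ξ
    rw [hφ.fourier_bsTest, bsMul, ← mul_assoc, ← mul_assoc, mul_comm (lpFat φ j ξ),
      hφ.lpMul_mul_lpFat]
  refine ⟨∑ l, (A l + B l), Finset.sum_nonneg fun l _ => add_nonneg (hA0 l) (hB0 l),
    fun T hT j l => ?_⟩
  have hb : 0 ≤ ∑ i ∈ Finset.Icc (-1 : ℤ) 1, blockNorm hφ T (j + i) :=
    Finset.sum_nonneg fun i _ => blockNorm_nonneg hφ T _
  constructor
  · intro x
    refine (norm_apply_le_of_localized hφ hT j (hloc j l x)).trans ?_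
    rw [mul_comm]
    refine mul_le_mul_of_nonneg_right ((hA l j x).trans ?_) hb
    exact mul_le_mul_of_nonneg_right (hAC l) (by positivity)
  · intro x y
    rw [← map_sub]
    refine (norm_apply_le_of_localized hφ hT j fun ξ => ?_).trans ?_
    · rw [AddSubgroupClass.coe_sub, fourier_sub_apply, mul_sub, ← hloc, ← hloc]
    rw [mul_comm]
    refine mul_le_mul_of_nonneg_right ((hB l j x y).trans ?_) hb
    exact mul_le_mul_of_nonneg_right (hBC l) (norm_nonneg _)

end BiotSavart

/-! ### Convergence of the Littlewood–Paley decomposition -/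

section Decomposition

variable {φ : Rd d → ℝ}

/-- Induction on the order of vanishing, for all derivatives at once: a bound on the derivative of
order `i + 1`, integrated along the segment from the origin, gains one power of `‖ξ‖`. -/
theorem exists_norm_iteratedFDeriv_le_of_flat {f : 𝓢(Rd d, ℂ)}
    (hf : ∀ n : ℕ, iteratedFDeriv ℝ n f 0 = 0) (M : ℕ) :
    ∀ i : ℕ, ∃ C : ℝ, 0 ≤ C ∧ ∀ ξ, ‖iteratedFDeriv ℝ i f ξ‖ ≤ C * ‖ξ‖ ^ M := by
  induction M with
  | zero =>
    intro i
    refine ⟨SchwartzMap.seminorm ℝ 0 i f, by positivity, fun ξ => ?_⟩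
    rw [pow_zero, mul_one]
    exact SchwartzMap.norm_iteratedFDeriv_le_seminorm ℝ f i ξ
  | succ M ih =>
    intro i
    obtain ⟨C, hC0, hC⟩ := ih (i + 1)
    refine ⟨C, hC0, fun ξ => ?_⟩
    have hd : Differentiable ℝ (iteratedFDeriv ℝ i f) :=
      (f.smooth (i + 1 : ℕ)).differentiable_iteratedFDeriv (by exact_mod_cast Nat.lt_succ_self i)
    have h := Convex.norm_image_sub_le_of_norm_fderiv_le (𝕜 := ℝ) (f := iteratedFDeriv ℝ i f)
      (s := Metric.closedBall 0 ‖ξ‖) (C := C * ‖ξ‖ ^ M) (x := 0) (y := ξ) (fun w _ => hd w)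
      (fun w hw => by
        rw [norm_fderiv_iteratedFDeriv]
        refine (hC w).trans ?_
        have : ‖w‖ ≤ ‖ξ‖ := by simpa using hw
        gcongr) (convex_closedBall 0 _) (by simp) (by simp)
    rw [hf i, sub_zero, sub_zero] at h
    rwa [pow_succ, ← mul_assoc]

theorem lpMul_eq_comp (φ : Rd d → ℝ) (j : ℤ) :
    lpMul φ j = fun ξ => lpMul φ 0 ((2 : ℝ) ^ (-j) • ξ) := by
  funext ξ
  simp [lpMul]

theorem IsLPGenerator.iteratedFDeriv_lpMul (hφ : IsLPGenerator φ) (i : ℕ) (j : ℤ) (ξ : Rd d) :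
    iteratedFDeriv ℝ i (lpMul φ j) ξ
      = ((2 : ℝ) ^ (-j)) ^ i • iteratedFDeriv ℝ i (lpMul φ 0) ((2 : ℝ) ^ (-j) • ξ) := by
  rw [lpMul_eq_comp φ j]
  have := iteratedFDeriv_comp_const_smul (𝕜 := ℝ) (i := i) ((2 : ℝ) ^ (-j))
    ((hφ.isAnnular_lpMul 0).smooth.of_le (by exact_mod_cast le_top))
  exact congrFun this ξ

theorem IsLPGenerator.bounds_of_iteratedFDeriv_ne_zero (hφ : IsLPGenerator φ) {i : ℕ} {j : ℤ}
    {ξ : Rd d} (h : iteratedFDeriv ℝ i (lpMul φ j) ξ ≠ 0) :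
    3 / 4 * 2 ^ j < ‖ξ‖ ∧ ‖ξ‖ < 7 / 4 * 2 ^ j := by
  rw [hφ.iteratedFDeriv_lpMul] at h
  have h1 : iteratedFDeriv ℝ i (lpMul φ 0) ((2 : ℝ) ^ (-j) • ξ) ≠ 0 := fun h0 => h (by
    rw [h0, smul_zero])
  have h2 : (2 : ℝ) ^ (-j) • ξ ∈ tsupport (lpMul φ 0) := support_iteratedFDeriv_subset i h1
  have h3 : tsupport (lpMul φ 0) ⊆ tsupport φ := by
    have : lpMul φ 0 = (fun t : ℝ => (t : ℂ)) ∘ φ := by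
      funext ξ
      simp [lpMul]
    rw [this]
    exact tsupport_comp_subset Complex.ofReal_zero φ
  have h4 := hφ.supp (h3 h2)
  simp only [Set.mem_ofPred_eq, norm_two_zpow_smul] at h4
  have hp : (0 : ℝ) < 2 ^ j := by positivity
  exact ⟨(lt_div_iff₀ hp).mp h4.1, (div_lt_iff₀ hp).mp h4.2⟩

theorem IsLPGenerator.exists_norm_iteratedFDeriv_lpMul_le (hφ : IsLPGenerator φ) (i : ℕ) :
    ∃ A : ℝ, 0 ≤ A ∧ ∀ j ξ, ‖iteratedFDeriv ℝ i (lpMul φ j) ξ‖ ≤ A * (((2 : ℝ) ^ j)⁻¹) ^ i := by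
  refine ⟨SchwartzMap.seminorm ℝ 0 i (hφ.isAnnular_lpMul 0).toSchwartz, by positivity,
    fun j ξ => ?_⟩
  rw [hφ.iteratedFDeriv_lpMul, norm_smul, Real.norm_of_nonneg (by positivity), mul_comm, zpow_neg]
  refine mul_le_mul_of_nonneg_right ?_ (by positivity)
  exact SchwartzMap.norm_iteratedFDeriv_le_seminorm ℝ (hφ.isAnnular_lpMul 0).toSchwartz i _

theorem summable_half_pow_natAbs : Summable fun j : ℤ => ((1 : ℝ) / 2) ^ j.natAbs := by
  apply Summable.of_nat_of_neg <;> simpa using summable_geometric_two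

/-- On the support `‖ξ‖` is comparable to `2^j`. For `j ≥ 0` one spare power of the decay of `f`
yields `2^{-j}`. For `j ≤ 0` differentiating the cutoff costs `2^{-ij}`, while flatness of order `i
+ 1` returns `2^{(i+1)j}`. -/
theorem IsLPGenerator.exists_seminorm_lpMul_mul_term_le (hφ : IsLPGenerator φ) {f : 𝓢(Rd d, ℂ)}
    (hf : ∀ n : ℕ, iteratedFDeriv ℝ n f 0 = 0) (k i n : ℕ) :
    ∃ C : ℝ, 0 ≤ C ∧ ∀ (j : ℤ) ξ, ‖ξ‖ ^ k * (‖iteratedFDeriv ℝ i (lpMul φ j) ξ‖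
      * ‖iteratedFDeriv ℝ n f ξ‖) ≤ C * (1 / 2) ^ j.natAbs := by
  obtain ⟨A, hA0, hA⟩ := hφ.exists_norm_iteratedFDeriv_lpMul_le i
  obtain ⟨B, hB0, hB⟩ := exists_norm_iteratedFDeriv_le_of_flat hf (i + 1) n
  set D := SchwartzMap.seminorm ℝ (k + 1) n f with hD
  have hD0 : 0 ≤ D := by positivity
  refine ⟨2 ^ k * A * (2 ^ (i + 1) * B) + A * (2 * D), by positivity, fun j ξ => ?_⟩
  by_cases h0 : iteratedFDeriv ℝ i (lpMul φ j) ξ = 0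
  · rw [h0, norm_zero, zero_mul, mul_zero]
    positivity
  obtain ⟨hlo, hhi⟩ := hφ.bounds_of_iteratedFDeriv_ne_zero h0
  have hAj := hA j ξ
  set R : ℝ := 2 ^ j with hR
  have hRpos : 0 < R := by positivity
  rcases le_total 0 j with hj | hj
  · have hpow : ((1 : ℝ) / 2) ^ j.natAbs = R⁻¹ := by
      obtain ⟨m, rfl⟩ := Int.eq_ofNat_of_zero_le hj
      simp [hR]
    have hR1 : 1 ≤ R := one_le_zpow₀ one_le_two hj
    have hA' : ‖iteratedFDeriv ℝ i (lpMul φ j) ξ‖ ≤ A :=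
      hAj.trans (mul_le_of_le_one_right hA0
        (pow_le_one₀ (by positivity) (inv_le_one_of_one_le₀ hR1)))
    have h1 : ‖ξ‖ ^ (k + 1) * ‖iteratedFDeriv ℝ n f ξ‖ ≤ D :=
      SchwartzMap.le_seminorm ℝ (k + 1) n f ξ
    have h2 : ‖ξ‖ ^ k * ‖iteratedFDeriv ℝ n f ξ‖ ≤ 2 * D * R⁻¹ := by
      rw [← div_eq_mul_inv, le_div_iff₀ hRpos]
      calc ‖ξ‖ ^ k * ‖iteratedFDeriv ℝ n f ξ‖ * R
          ≤ ‖ξ‖ ^ k * ‖iteratedFDeriv ℝ n f ξ‖ * (2 * ‖ξ‖) := by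
            gcongr
            linarith
        _ = 2 * (‖ξ‖ ^ (k + 1) * ‖iteratedFDeriv ℝ n f ξ‖) := by ring
        _ ≤ 2 * D := by gcongr
    rw [hpow]
    calc ‖ξ‖ ^ k * (‖iteratedFDeriv ℝ i (lpMul φ j) ξ‖ * ‖iteratedFDeriv ℝ n f ξ‖)
        = ‖iteratedFDeriv ℝ i (lpMul φ j) ξ‖ * (‖ξ‖ ^ k * ‖iteratedFDeriv ℝ n f ξ‖) := by ring
      _ ≤ A * (2 * D * R⁻¹) := by gcongr
      _ = A * (2 * D) * R⁻¹ := by ring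
      _ ≤ _ := mul_le_mul_of_nonneg_right (le_add_of_nonneg_left (by positivity)) (by positivity)
  · have hpow : ((1 : ℝ) / 2) ^ j.natAbs = R := by
      obtain ⟨m, rfl⟩ := Int.exists_eq_neg_ofNat hj
      simp [hR]
    have hR1 : R ≤ 1 := zpow_le_one_of_nonpos₀ one_le_two hj
    have hξ : ‖ξ‖ ≤ 2 * R := by linarith
    rw [hpow]
    calc ‖ξ‖ ^ k * (‖iteratedFDeriv ℝ i (lpMul φ j) ξ‖ * ‖iteratedFDeriv ℝ n f ξ‖)
        ≤ (2 * 1) ^ k * ((A * (R⁻¹) ^ i) * (B * (2 * R) ^ (i + 1))) := by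
          gcongr
          · linarith
          · exact (hB ξ).trans (by gcongr)
      _ = 2 ^ k * A * (2 ^ (i + 1) * B) * R := by
          have : (R⁻¹) ^ i * R ^ (i + 1) = R := by
            rw [pow_succ, ← mul_assoc, ← mul_pow, inv_mul_cancel₀ hRpos.ne', one_pow, one_mul]
          rw [mul_pow 2 R, mul_one]
          linear_combination (2 ^ k * A * (2 ^ (i + 1) * B)) * this
      _ ≤ _ := mul_le_mul_of_nonneg_right (le_add_of_nonneg_right (by positivity)) hRpos.le

theorem IsLPGenerator.exists_seminorm_lpMul_mul_le (hφ : IsLPGenerator φ) {f : 𝓢(Rd d, ℂ)}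
    (hf : ∀ n : ℕ, iteratedFDeriv ℝ n f 0 = 0) (k n : ℕ) :
    ∃ C : ℝ, 0 ≤ C ∧ ∀ (j : ℤ) ξ, ‖ξ‖ ^ k *
      ‖iteratedFDeriv ℝ n (fun ξ => lpMul φ j ξ * f ξ) ξ‖ ≤ C * (1 / 2) ^ j.natAbs := by
  choose C hC0 hC using fun i => hφ.exists_seminorm_lpMul_mul_term_le hf k i (n - i)
  refine ⟨∑ i ∈ Finset.range (n + 1), (n.choose i : ℝ) * C i,
    Finset.sum_nonneg fun i _ => mul_nonneg (by positivity) (hC0 i), fun j ξ => ?_⟩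
  have h := norm_iteratedFDeriv_mul_le ((hφ.isAnnular_lpMul j).smooth.of_le
    (by exact_mod_cast le_top)) (f.smooth n) ξ (n := n) le_rfl
  refine (mul_le_mul_of_nonneg_left h (by positivity)).trans ?_
  rw [Finset.mul_sum, Finset.sum_mul]
  refine Finset.sum_le_sum fun i _ => ?_
  calc ‖ξ‖ ^ k * ((n.choose i : ℝ) * ‖iteratedFDeriv ℝ i (lpMul φ j) ξ‖ *
        ‖iteratedFDeriv ℝ (n - i) f ξ‖)
      = (n.choose i : ℝ) * (‖ξ‖ ^ k * (‖iteratedFDeriv ℝ i (lpMul φ j) ξ‖ *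
        ‖iteratedFDeriv ℝ (n - i) f ξ‖)) := by ring
    _ ≤ (n.choose i : ℝ) * (C i * (1 / 2) ^ j.natAbs) :=
        mul_le_mul_of_nonneg_left (hC i j ξ) (by positivity)
    _ = _ := by ring

/-- Geometric bounds in `|j|` allow termwise differentiation of the decomposition, so the error is
controlled by the tail outside `S`. -/
theorem IsLPGenerator.seminorm_sub_sum_le (hφ : IsLPGenerator φ) {f : 𝓢(Rd d, ℂ)}
    (hf : ∀ n : ℕ, iteratedFDeriv ℝ n f 0 = 0) (k n : ℕ) :
    ∃ C : ℝ, 0 ≤ C ∧ ∀ (S : Finset ℤ) (g : 𝓢(Rd d, ℂ)),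
      (∀ ξ, g ξ = (∑ j ∈ S, lpMul φ j ξ * f ξ) - f ξ) →
      SchwartzMap.seminorm ℂ k n g
        ≤ C * ∑' j : {j : ℤ // j ∉ S}, ((1 : ℝ) / 2) ^ (j : ℤ).natAbs := by
  obtain ⟨C, hC0, hC⟩ := hφ.exists_seminorm_lpMul_mul_le hf k n
  choose D hD0 hD using fun m => hφ.exists_seminorm_lpMul_mul_le hf 0 m
  refine ⟨C, hC0, fun S g hg => ?_⟩
  refine SchwartzMap.seminorm_le_bound ℂ k n g
    (mul_nonneg hC0 (tsum_nonneg fun j => by positivity)) fun ξ => ?_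
  let F : ℤ → Rd d → ℂ := fun j ξ => lpMul φ j ξ * f ξ
  have hFs : ∀ j, ContDiff ℝ (⊤ : ℕ∞) (F j) := fun j =>
    (hφ.isAnnular_lpMul j).smooth.mul (f.smooth _)
  have hDb : ∀ (m : ℕ) (j : ℤ) (ξ : Rd d), (m : ℕ∞) ≤ (⊤ : ℕ∞) →
      ‖iteratedFDeriv ℝ m (F j) ξ‖ ≤ D m * (1 / 2) ^ j.natAbs := fun m j ξ _ => by
    simpa using hD m j ξ
  have hDs : ∀ m : ℕ, (m : ℕ∞) ≤ (⊤ : ℕ∞) →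
      Summable fun j : ℤ => D m * ((1 : ℝ) / 2) ^ j.natAbs := fun m _ =>
    summable_half_pow_natAbs.mul_left _
  have hfF : (⇑f : Rd d → ℂ) = fun ξ => ∑' j, F j ξ := by
    funext ξ
    -- The partition of unity fails at the origin, but there `f` vanishes.
    by_cases hξ : ξ = 0
    · subst hξ
      have : f 0 = 0 := by
        have := hf 0
        rwa [← norm_eq_zero, norm_iteratedFDeriv_zero, norm_eq_zero] at this
      simp [F, this]
    · exact ((one_mul (f ξ)) ▸ (hφ.hasSum_lpMul hξ).mul_right (f ξ)).tsum_eq.symm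
  have hderiv : iteratedFDeriv ℝ n f ξ = ∑' j, iteratedFDeriv ℝ n (F j) ξ := by
    conv_lhs => rw [hfF]
    exact iteratedFDeriv_tsum_apply hFs hDs hDb le_top ξ
  have hgF : (⇑g : Rd d → ℂ) = (fun ξ => ∑ j ∈ S, F j ξ) - ⇑f := funext hg
  have hsm : ∀ j ∈ S, ContDiff ℝ n (F j) := fun j _ => (hFs j).of_le (by exact_mod_cast le_top)
  have hsumm : Summable fun j => iteratedFDeriv ℝ n (F j) ξ :=
    Summable.of_norm_bounded (hDs n le_top) fun j => hDb n j ξ le_top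
  have hgd : iteratedFDeriv ℝ n g ξ = -∑' j : {j : ℤ // j ∉ S}, iteratedFDeriv ℝ n (F j) ξ := by
    rw [hgF, iteratedFDeriv_sub_apply (ContDiff.sum hsm).contDiffAt (f.smooth n).contDiffAt,
      iteratedFDeriv_sum hsm, hderiv, ← hsumm.sum_add_tsum_subtype_compl S]
    simp
  rw [hgd, norm_neg, ← Real.norm_of_nonneg (by positivity : 0 ≤ ‖ξ‖ ^ k), ← norm_smul,
    ← tsum_const_smul'', ← tsum_mul_left]
  refine tsum_of_norm_bounded ((summable_half_pow_natAbs.subtype _).mul_left C).hasSum fun j => ?_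
  rw [norm_smul, Real.norm_of_nonneg (by positivity)]
  exact hC j ξ

/-- The Littlewood–Paley decomposition of a test function converges in `schwartzDot d`. -/
theorem IsLPGenerator.hasSum_lpMul_fourier (hφ : IsLPGenerator φ) (η : schwartzDot d) :
    HasSum (fun j : ℤ => ofFourier fun ξ =>
      lpMul φ j ξ * (𝓕 (η : 𝓢(Rd d, ℂ)) : 𝓢(Rd d, ℂ)) ξ) η := by
  let F : schwartzDot d →ₗ[ℂ] 𝓢(Rd d, ℂ) :=
    (FourierTransform.fourierCLE ℂ 𝓢(Rd d, ℂ)).toLinearMap ∘ₗ (schwartzDot d).subtype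
  have hF : Topology.IsInducing F :=
    (FourierTransform.fourierCLE ℂ 𝓢(Rd d, ℂ)).toHomeomorph.isInducing.comp .subtypeVal
  have hann : ∀ j, IsAnnular fun ξ => lpMul φ j ξ * (𝓕 (η : 𝓢(Rd d, ℂ)) : 𝓢(Rd d, ℂ)) ξ :=
    fun j => (hφ.isAnnular_lpMul j).mul (SchwartzMap.smooth _ _)
  have hflat : ∀ n : ℕ, iteratedFDeriv ℝ n (F η) 0 = 0 := η.2
  rw [HasSum, hF.tendsto_nhds_iff, (schwartz_withSeminorms ℂ (Rd d) ℂ).tendsto_nhds]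
  rintro ⟨k, n⟩ ε hε
  obtain ⟨C, hC0, hC⟩ := hφ.seminorm_sub_sum_le hflat k n
  have hlim : Tendsto (fun S : Finset ℤ =>
      C * ∑' j : {j : ℤ // j ∉ S}, ((1 : ℝ) / 2) ^ (j : ℤ).natAbs) atTop (𝓝 0) := by
    simpa using (tendsto_tsum_compl_atTop_zero
      (fun j : ℤ => ((1 : ℝ) / 2) ^ j.natAbs)).const_mul C
  filter_upwards [hlim.eventually_lt_const hε] with S hS
  refine (hC S _ fun ξ => ?_).trans_lt hS
  rw [_root_.sub_apply, Function.comp_apply, ← ofFourier_sum hann]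
  congr 1
  exact fourier_ofFourier (IsAnnular.sum fun j _ => hann j) ξ

end Decomposition

/-! ### Existence of a velocity -/

section Existence

variable {φ : Rd 2 → ℝ}

theorem conj_chr (x ξ : Rd d) : (starRingEnd ℂ) (chr x ξ) = chr x (-ξ) := by
  rw [chr, chr, ← Complex.exp_conj, map_mul, Complex.conj_ofReal, Complex.conj_I, inner_neg_right]
  congr 1
  push_cast
  ring

theorem ofFourier_im_eq_zero {h : Rd d → ℂ} (hh : IsAnnular h)
    (hsymm : ∀ ξ, (starRingEnd ℂ) (h ξ) = h (-ξ)) (z : Rd d) :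
    ((ofFourier h : 𝓢(Rd d, ℂ)) z).im = 0 := by
  rw [← Complex.conj_eq_iff_im, ofFourier_apply hh, ← integral_conj,
    ← integral_neg_eq_self]
  refine integral_congr_ae (Eventually.of_forall fun ξ => ?_)
  simp only [map_mul, hsymm, neg_neg]
  rw [← Complex.exp_conj, map_mul, Complex.conj_ofReal, Complex.conj_I, inner_neg_left]
  congr 2
  push_cast
  ring

theorem IsLPGenerator.bsTest_im (hφ : IsLPGenerator φ) (j : ℤ) (l : Fin 2) (x z : Rd 2) :
    ((bsTest φ j l x : 𝓢(Rd 2, ℂ)) z).im = 0 := by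
  refine ofFourier_im_eq_zero (hφ.isAnnular_bsMul_chr j l x) (fun ξ => ?_) z
  have h1 : lpMul φ j (-ξ) = lpMul φ j ξ := by
    rw [lpMul, lpMul, smul_neg, hφ.radial _ ((2 : ℝ) ^ (-j) • ξ) (norm_neg _)]
  rw [bsMul, bsMul, map_mul, map_mul, conj_chr, conj_biotSavartSymbol, h1]
  congr 2
  rw [lpMul, Complex.conj_ofReal]

/-- This is the Biot–Savart law for a single block. The integral over `x` is a superposition of
localized kernels with density `ψ`, and its Fourier transform is the `j`-th piece of `η`. -/
theorem IsLPGenerator.integral_apply_bsTest (hφ : IsLPGenerator φ) (T : DistDot 2) (j : ℤ)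
    (l : Fin 2) {ψ η : schwartzDot 2}
    (hη : ∀ ξ : Rd 2, (𝓕 (η : 𝓢(Rd 2, ℂ)) : 𝓢(Rd 2, ℂ)) ξ
      = biotSavartSymbol l (-ξ) * (𝓕 (ψ : 𝓢(Rd 2, ℂ)) : 𝓢(Rd 2, ℂ)) ξ) :
    ∫ x, T (bsTest φ j l x) * (ψ : 𝓢(Rd 2, ℂ)) x
      = T (ofFourier fun ξ => lpMul φ j ξ * (𝓕 (η : 𝓢(Rd 2, ℂ)) : 𝓢(Rd 2, ℂ)) ξ) := by
  have h := T.apply_mul_fourier (hφ.isAnnular_lpFat j) (hφ.isAnnular_bsMul j l)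
    (ψ : 𝓢(Rd 2, ℂ))
  have h1 : ∀ ξ, lpFat φ j ξ * bsMul φ j l ξ = bsMul φ j l ξ := fun ξ => by
    rw [bsMul, ← mul_assoc, mul_comm (lpFat φ j ξ), hφ.lpMul_mul_lpFat]
  simp only [← mul_assoc, h1] at h
  simp only [hη, ← mul_assoc]
  refine Eq.trans ?_ h.symm
  refine integral_congr_ae (Eventually.of_forall fun x => ?_)
  exact mul_comm _ _

/-- A vorticity with summable `2^{-j} ‖Δ_j ω‖_∞` has a velocity. -/
theorem IsLPGenerator.exists_isVelocity (hφ : IsLPGenerator φ) {T : DistDot 2}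
    (hT : ∀ j, lpBlockNorm hφ j T ≠ ⊤)
    (hsum : Summable fun j : ℤ => ((2 : ℝ) ^ j)⁻¹ *
      ∑ i ∈ Finset.Icc (-1 : ℤ) 1, blockNorm hφ T (j + i)) :
    ∃ v : Rd 2 → EuclideanSpace ℂ (Fin 2), IsVelocity T v ∧
      (T.IsReal → ∀ x l, (v x l).im = 0) := by
  obtain ⟨C, hC0, hC⟩ := hφ.exists_bsTest_bounds
  set B : ℤ → ℝ := fun j => C * (((2 : ℝ) ^ j)⁻¹ *
      ∑ i ∈ Finset.Icc (-1 : ℤ) 1, blockNorm hφ T (j + i)) with hBdef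
  have hBs : Summable B := hsum.mul_left C
  have hB : ∀ j l x, ‖T (bsTest φ j l x)‖ ≤ B j := fun j l x => by
    rw [hBdef]
    simp only [← mul_assoc]
    exact (hC T hT j l).1 x
  have hcont : ∀ j l, Continuous fun x => T (bsTest φ j l x) := by
    intro j l
    rw [continuous_iff_continuousAt]
    intro x
    rw [ContinuousAt, tendsto_iff_norm_sub_tendsto_zero]
    refine squeeze_zero (fun _ => norm_nonneg _) (fun y => (hC T hT j l).2 y x) ?_
    have : Continuous fun y : Rd 2 => C * ‖y - x‖ *
      ∑ i ∈ Finset.Icc (-1 : ℤ) 1, blockNorm hφ T (j + i) := by fun_prop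
    simpa using this.tendsto x
  -- The velocity is the sum of its blocks; the summable majorant `B` makes the series uniformly
  -- convergent, hence bounded and continuous.
  let u : Fin 2 → Rd 2 → ℂ := fun l x => ∑' j, T (bsTest φ j l x)
  have hus : ∀ l x, Summable fun j => T (bsTest φ j l x) := fun l x =>
    Summable.of_norm_bounded hBs fun j => hB j l x
  have hub : ∀ l x, ‖u l x‖ ≤ ∑' j, B j := fun l x =>
    tsum_of_norm_bounded hBs.hasSum fun j => hB j l x
  have huc : ∀ l, Continuous (u l) := fun l => continuous_tsum (fun j => hcont j l) hBs
    fun j x => hB j l x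
  refine ⟨fun x => WithLp.toLp 2 fun l => u l x, ⟨?_, ?_, ?_⟩, ?_⟩
  · exact (PiLp.continuous_toLp 2 _).comp (continuous_pi huc)
  · refine ⟨Real.sqrt (∑ _l : Fin 2, (∑' j, B j) ^ 2), fun x => ?_⟩
    rw [EuclideanSpace.norm_eq]
    refine Real.sqrt_le_sqrt (Finset.sum_le_sum fun l _ => ?_)
    exact pow_le_pow_left₀ (norm_nonneg _) (hub l x) 2
  · intro l ψ η hη
    have hint : ∀ j, Integrable fun x => T (bsTest φ j l x) * (ψ : 𝓢(Rd 2, ℂ)) x := fun j =>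
      (ψ : 𝓢(Rd 2, ℂ)).integrable.bdd_mul (hcont j l).aestronglyMeasurable
        (Eventually.of_forall fun x => hB j l x)
    have hnorm : Summable fun j => ∫ x, ‖T (bsTest φ j l x) * (ψ : 𝓢(Rd 2, ℂ)) x‖ := by
      refine Summable.of_nonneg_of_le (fun j => integral_nonneg fun _ => norm_nonneg _)
        (fun j => ?_) (hBs.mul_right (∫ x, ‖(ψ : 𝓢(Rd 2, ℂ)) x‖))
      rw [← integral_const_mul]
      refine integral_mono (hint j).norm ((ψ : 𝓢(Rd 2, ℂ)).integrable.norm.const_mul _)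
        fun x => ?_
      rw [norm_mul]
      exact mul_le_mul_of_nonneg_right (hB j l x) (norm_nonneg _)
    -- Both sides of the law are expanded into Littlewood–Paley series, which agree term by term.
    have h1 := hasSum_integral_of_summable_integral_norm hint hnorm
    have h2 : HasSum (fun j => T (ofFourier fun ξ =>
        lpMul φ j ξ * (𝓕 (η : 𝓢(Rd 2, ℂ)) : 𝓢(Rd 2, ℂ)) ξ)) (T η) :=
      T.hasSum (hφ.hasSum_lpMul_fourier η)
    simp only [hφ.integral_apply_bsTest T _ l hη, tsum_mul_right] at h1
    exact h1.unique h2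
  · intro hreal x l
    change (∑' j, T (bsTest φ j l x)).im = 0
    rw [Complex.im_tsum (hus l x)]
    simp [hreal (bsTest φ _ l x) (hφ.bsTest_im _ l x)]

end Existence

/-! ### Low-frequency cutoffs -/

section LowPass

variable {φ : Rd d → ℝ}

/-- The sum of the dilated generators of non-positive index, extended by `1` at the origin. -/
def lowPass (φ : Rd d → ℝ) (ξ : Rd d) : ℂ :=
  open Classical in if ξ = 0 then 1 else ∑' j : ℕ, lpMul φ (-(j : ℤ)) ξ

theorem lowPass_zero (φ : Rd d → ℝ) : lowPass φ 0 = 1 := by simp [lowPass]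

theorem lpMul_two_zpow_smul (φ : Rd d → ℝ) (j k : ℤ) (ξ : Rd d) :
    lpMul φ j ((2 : ℝ) ^ (-k) • ξ) = lpMul φ (j + k) ξ := by
  rw [lpMul, lpMul, smul_smul, ← zpow_add₀ two_ne_zero, neg_add]

theorem injective_neg_natCast : Function.Injective fun j : ℕ => -(j : ℤ) := fun a b h => by
  simpa using h

/-- The two sums differ only in their top term. This identity drives the telescoping of
low-frequency truncations. -/
theorem IsLPGenerator.lowPass_sub (hφ : IsLPGenerator φ) (j : ℤ) (ξ : Rd d) :
    lowPass φ ((2 : ℝ) ^ (-j) • ξ) - lowPass φ ((2 : ℝ) ^ (-(j - 1)) • ξ) = lpMul φ j ξ := by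
  by_cases hξ : ξ = 0
  · subst hξ
    simp [hφ.lpMul_zero]
  have hne : ∀ k : ℤ, (2 : ℝ) ^ (-k) • ξ ≠ 0 := fun k =>
    smul_ne_zero (zpow_ne_zero _ two_ne_zero) hξ
  rw [lowPass, lowPass, if_neg (hne j), if_neg (hne (j - 1))]
  simp only [lpMul_two_zpow_smul]
  have hs : Summable fun i : ℕ => lpMul φ (-(i : ℤ) + j) ξ :=
    (hφ.hasSum_lpMul hξ).summable.comp_injective
      ((add_left_injective j).comp injective_neg_natCast)
  rw [hs.tsum_eq_zero_add]
  have h2 : ∀ i : ℕ, lpMul φ (-((i + 1 : ℕ) : ℤ) + j) ξ = lpMul φ (-(i : ℤ) + (j - 1)) ξ :=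
    fun i => by
      congr 1
      push_cast
      ring
  simp only [h2, Nat.cast_zero, neg_zero, zero_add, add_sub_cancel_right]

/-- The omitted generators, of index at least `1`, live where `‖ξ‖ > 3/2`. -/
theorem IsLPGenerator.lowPass_eq_one (hφ : IsLPGenerator φ) {ξ : Rd d} (h : ‖ξ‖ < 3 / 2) :
    lowPass φ ξ = 1 := by
  by_cases hξ : ξ = 0
  · rw [hξ, lowPass_zero]
  rw [lowPass, if_neg hξ]
  refine HasSum.tsum_eq ((injective_neg_natCast.hasSum_iff fun j hj => ?_).mpr
    (hφ.hasSum_lpMul hξ))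
  by_contra hne
  have hb := (hφ.bounds_of_lpMul_ne_zero hne).1
  have hj1 : 1 ≤ j := by
    by_contra hlt
    exact hj ⟨(-j).toNat, by simp only; omega⟩
  have : (2 : ℝ) ^ (1 : ℤ) ≤ 2 ^ j := zpow_le_zpow_right₀ one_le_two hj1
  norm_num at this
  linarith

theorem IsLPGenerator.lowPass_eq_add (hφ : IsLPGenerator φ) {ξ : Rd d} (h : 1 < ‖ξ‖) :
    lowPass φ ξ = lpMul φ 0 ξ + lpMul φ (-1) ξ := by
  have hξ : ξ ≠ 0 := by
    rintro rfl
    norm_num at h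
  rw [lowPass, if_neg hξ, tsum_eq_sum (s := Finset.range 2)]
  · simp [Finset.sum_range_succ]
  · intro j hj
    by_contra hne
    have hb := (hφ.bounds_of_lpMul_ne_zero hne).2
    have hj2 : -(j : ℤ) ≤ -2 := by
      have := Finset.mem_range.not.mp hj
      omega
    have : (2 : ℝ) ^ (-(j : ℤ)) ≤ 2 ^ (-2 : ℤ) := zpow_le_zpow_right₀ one_le_two hj2
    norm_num at this hb
    linarith

/-- The open sets `‖ξ‖ < 3/2` and `‖ξ‖ > 1` cover the space; the cutoff is constant on the first and
a sum of two generators on the second. -/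
theorem IsLPGenerator.contDiff_lowPass (hφ : IsLPGenerator φ) :
    ContDiff ℝ (⊤ : ℕ∞) (lowPass φ) := by
  rw [contDiff_iff_contDiffAt]
  intro ξ
  rcases lt_or_ge ‖ξ‖ (3 / 2) with h | h
  · refine (contDiffAt_const (c := (1 : ℂ))).congr_of_eventuallyEq ?_
    filter_upwards [continuous_norm.continuousAt.eventually_lt_const h] with η hη
    exact hφ.lowPass_eq_one hη
  · refine ((hφ.isAnnular_lpMul 0).smooth.add
      (hφ.isAnnular_lpMul (-1)).smooth).contDiffAt.congr_of_eventuallyEq ?_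
    filter_upwards [continuous_norm.continuousAt.eventually_const_lt
      (lt_of_lt_of_le (by norm_num : (1 : ℝ) < 3 / 2) h)] with η hη
    exact hφ.lowPass_eq_add hη

theorem IsLPGenerator.hasCompactSupport_lowPass (hφ : IsLPGenerator φ) :
    HasCompactSupport (lowPass φ) := by
  refine HasCompactSupport.of_support_subset_isCompact (isCompact_closedBall (0 : Rd d) (7 / 4)) ?_
  intro ξ hξ
  by_contra hlt
  rw [mem_closedBall_zero_iff, not_le] at hlt
  apply hξ
  rw [hφ.lowPass_eq_add (by linarith)]
  have h0 : lpMul φ 0 ξ = 0 := by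
    by_contra hne
    have := (hφ.bounds_of_lpMul_ne_zero hne).2
    norm_num at this
    linarith
  have h1 : lpMul φ (-1) ξ = 0 := by
    by_contra hne
    have := (hφ.bounds_of_lpMul_ne_zero hne).2
    norm_num at this
    linarith
  rw [h0, h1, add_zero]

/-- The convolution kernel of the low-frequency cutoff. -/
def lowKernel (hφ : IsLPGenerator φ) : 𝓢(Rd d, ℂ) :=
  𝓕⁻ (hφ.hasCompactSupport_lowPass.toSchwartzMap hφ.contDiff_lowPass)

theorem lowKernel_apply (hφ : IsLPGenerator φ) (x : Rd d) :
    lowKernel hφ x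
      = ∫ ξ, Complex.exp (((2 * Real.pi * inner ℝ ξ x : ℝ) : ℂ) * Complex.I) * lowPass φ ξ := by
  rw [lowKernel, SchwartzMap.fourierInv_coe, Real.fourierInv_eq']
  rfl

theorem integral_lowKernel (hφ : IsLPGenerator φ) : ∫ x, lowKernel hφ x = 1 := by
  have h : (𝓕 (lowKernel hφ) : 𝓢(Rd d, ℂ)) 0 = 1 := by
    rw [lowKernel, FourierTransform.fourier_fourierInv_eq]
    exact lowPass_zero φ
  rw [SchwartzMap.fourier_coe, Real.fourier_eq'] at h
  simpa using h

theorem two_zpow_mul_lowKernel (hφ : IsLPGenerator φ) (j : ℤ) (x z : Rd d) :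
    (((2 : ℂ) ^ j) ^ d) * lowKernel hφ ((2 : ℝ) ^ j • (z - x))
      = ∫ ξ, Complex.exp (((2 * Real.pi * inner ℝ ξ z : ℝ) : ℂ) * Complex.I)
        * (lowPass φ ((2 : ℝ) ^ (-j) • ξ) * chr x ξ) := by
  have hR : (0 : ℝ) < 2 ^ j := by positivity
  have hc := Measure.integral_comp_smul (volume : Measure (Rd d)) (fun ξ : Rd d =>
    Complex.exp (((2 * Real.pi * inner ℝ ξ z : ℝ) : ℂ) * Complex.I)
      * (lowPass φ ((2 : ℝ) ^ (-j) • ξ) * chr x ξ)) ((2 : ℝ) ^ j)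
  simp only [finrank_euclideanSpace, Fintype.card_fin] at hc
  rw [abs_of_pos (by positivity), eq_inv_smul_iff₀ (by positivity)] at hc
  rw [← hc, lowKernel_apply, Complex.real_smul]
  push_cast
  congr 1
  refine integral_congr_ae (Eventually.of_forall fun ζ => ?_)
  have h1 : (2 : ℝ) ^ (-j) • (2 : ℝ) ^ j • ζ = ζ := by
    rw [smul_smul, ← zpow_add₀ two_ne_zero]
    simp
  simp only [h1]
  rw [mul_comm (lowPass φ ζ), ← mul_assoc]
  congr 1
  rw [chr, ← Complex.exp_add, ← add_mul]
  congr 2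
  rw [inner_smul_right, inner_sub_right, inner_smul_left, inner_smul_right,
    real_inner_comm x ζ]
  simp only [conj_trivial]
  push_cast
  ring

theorem ofFourier_lpSymbol_apply (hφ : IsLPGenerator φ) (j : ℤ) (x z : Rd d) :
    (ofFourier (lpSymbol φ j x) : 𝓢(Rd d, ℂ)) z
      = (((2 : ℂ) ^ j) ^ d) * lowKernel hφ ((2 : ℝ) ^ j • (z - x))
        - (((2 : ℂ) ^ (j - 1)) ^ d) * lowKernel hφ ((2 : ℝ) ^ (j - 1) • (z - x)) := by
  have hint : ∀ k : ℤ, Integrable fun ξ : Rd d =>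
      Complex.exp (((2 * Real.pi * inner ℝ ξ z : ℝ) : ℂ) * Complex.I)
        * (lowPass φ ((2 : ℝ) ^ (-k) • ξ) * chr x ξ) := by
    intro k
    have hcs : HasCompactSupport fun ξ : Rd d => lowPass φ ((2 : ℝ) ^ (-k) • ξ) :=
      hφ.hasCompactSupport_lowPass.comp_smul (zpow_ne_zero _ two_ne_zero)
    refine Continuous.integrable_of_hasCompactSupport ?_ (hcs.mul_right.mul_left)
    have h1 := hφ.contDiff_lowPass.continuous
    have h2 := (contDiff_chr x).continuous
    fun_prop
  rw [two_zpow_mul_lowKernel, two_zpow_mul_lowKernel, ← integral_sub (hint j) (hint (j - 1)),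
    ofFourier_apply (hφ.isAnnular_lpSymbol j x)]
  refine integral_congr_ae (Eventually.of_forall fun ξ => ?_)
  simp only [lpSymbol_eq, ← hφ.lowPass_sub j ξ]
  ring

/-- The low-frequency truncation of a function at scale `2^j`. -/
def lowPart (hφ : IsLPGenerator φ) (w : Rd d → ℂ) (j : ℤ) (x : Rd d) : ℂ :=
  ∫ z, w z * ((((2 : ℂ) ^ j) ^ d) * lowKernel hφ ((2 : ℝ) ^ j • (z - x)))

variable {w : Rd d → ℂ} {M : ℝ}

theorem integrable_lowPart (hφ : IsLPGenerator φ) (hw : Continuous w) (hM : ∀ x, ‖w x‖ ≤ M)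
    (j : ℤ) (x : Rd d) :
    Integrable fun z => w z * ((((2 : ℂ) ^ j) ^ d) * lowKernel hφ ((2 : ℝ) ^ j • (z - x))) := by
  refine Integrable.bdd_mul ?_ hw.aestronglyMeasurable (Eventually.of_forall hM)
  refine Integrable.const_mul ?_ _
  exact ((integrable_comp_smul_iff volume (lowKernel hφ)
    (zpow_ne_zero j two_ne_zero)).mpr (lowKernel hφ).integrable).comp_sub_right x

theorem lowPart_sub_lowPart (hφ : IsLPGenerator φ) (hw : Continuous w) (hM : ∀ x, ‖w x‖ ≤ M)
    (j : ℤ) (x : Rd d) :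
    lowPart hφ w j x - lowPart hφ w (j - 1) x
      = ∫ z, w z * (ofFourier (lpSymbol φ j x) : 𝓢(Rd d, ℂ)) z := by
  rw [lowPart, lowPart, ← integral_sub (integrable_lowPart hφ hw hM j x)
    (integrable_lowPart hφ hw hM (j - 1) x)]
  refine integral_congr_ae (Eventually.of_forall fun z => ?_)
  simp only [ofFourier_lpSymbol_apply hφ]
  ring

theorem lowPart_eq (hφ : IsLPGenerator φ) (w : Rd d → ℂ) (j : ℤ) (x : Rd d) :
    lowPart hφ w j x = ∫ u, w (((2 : ℝ) ^ j)⁻¹ • u + x) * lowKernel hφ u := by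
  have hR : (0 : ℝ) < 2 ^ j := by positivity
  have hc := Measure.integral_comp_smul (volume : Measure (Rd d)) (fun u : Rd d =>
    w (((2 : ℝ) ^ j)⁻¹ • u + x) * lowKernel hφ u) ((2 : ℝ) ^ j)
  simp only [finrank_euclideanSpace, Fintype.card_fin] at hc
  rw [abs_of_pos (by positivity), eq_inv_smul_iff₀ (by positivity)] at hc
  rw [← hc, lowPart, ← integral_add_right_eq_self _ x, ← integral_smul]
  refine integral_congr_ae (Eventually.of_forall fun u => ?_)
  simp only [add_sub_cancel_right, smul_smul, inv_mul_cancel₀ hR.ne', one_smul, Complex.real_smul]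
  push_cast
  ring

/-- The rescaled kernels form an approximate identity, having total mass `lowPass φ 0 = 1`. -/
theorem tendsto_lowPart (hφ : IsLPGenerator φ) (hw : Continuous w) (hM : ∀ x, ‖w x‖ ≤ M)
    (x : Rd d) : Tendsto (fun n : ℕ => lowPart hφ w n x) atTop (𝓝 (w x)) := by
  have h1 : w x = ∫ u, w x * lowKernel hφ u := by
    rw [integral_const_mul, integral_lowKernel, mul_one]
  rw [h1]
  simp only [lowPart_eq hφ w]
  refine tendsto_integral_of_dominated_convergence (fun u => M * ‖lowKernel hφ u‖) ?_ ?_ ?_ ?_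
  · intro n
    have := (lowKernel hφ).continuous
    exact Continuous.aestronglyMeasurable (by fun_prop)
  · exact (lowKernel hφ).integrable.norm.const_mul M
  · intro n
    refine Eventually.of_forall fun u => ?_
    rw [norm_mul]
    exact mul_le_mul_of_nonneg_right (hM _) (norm_nonneg _)
  · refine Eventually.of_forall fun u => ?_
    refine Tendsto.mul_const _ ?_
    have h2 : Tendsto (fun n : ℕ => ((2 : ℝ) ^ (n : ℤ))⁻¹) atTop (𝓝 0) := by
      simp only [zpow_natCast]
      exact tendsto_inv_atTop_zero.comp (tendsto_pow_atTop_atTop_of_one_lt one_lt_two)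
    have h3 : Tendsto (fun n : ℕ => ((2 : ℝ) ^ (n : ℤ))⁻¹ • u + x) atTop (𝓝 ((0 : ℝ) • u + x)) :=
      (h2.smul_const u).add_const x
    rw [zero_smul, zero_add] at h3
    exact (hw.tendsto x).comp h3

/-- Boundedness of `w` gives the truncation at scale `2^j` a Lipschitz constant of order `2^j`.
Letting `j → -∞` removes the part of `w` that the blocks cannot see. -/
theorem exists_norm_lowPart_sub_le (hφ : IsLPGenerator φ) (hw : Continuous w)
    (hM : ∀ x, ‖w x‖ ≤ M) :
    ∃ C : ℝ, ∀ (j : ℤ) (x y : Rd d),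
      ‖lowPart hφ w j x - lowPart hφ w j y‖ ≤ C * 2 ^ j * ‖x - y‖ := by
  obtain ⟨C, hC0, hC⟩ := (lowKernel hφ).exists_integral_translate_sub_le
  have hM0 : 0 ≤ M := (norm_nonneg _).trans (hM 0)
  refine ⟨M * C, fun j x y => ?_⟩
  have hR : (0 : ℝ) < 2 ^ j := by positivity
  rw [lowPart, lowPart, ← integral_sub (integrable_lowPart hφ hw hM j x)
    (integrable_lowPart hφ hw hM j y)]
  set g : Rd d → ℝ := fun z => ‖lowKernel hφ (z - (2 : ℝ) ^ j • x)
    - lowKernel hφ (z - (2 : ℝ) ^ j • y)‖ with hg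
  have hgi : Integrable g := (((lowKernel hφ).integrable.comp_sub_right _).sub
    ((lowKernel hφ).integrable.comp_sub_right _)).norm
  have hgR : Integrable fun z : Rd d => M * (((2 : ℝ) ^ j) ^ d * g ((2 : ℝ) ^ j • z)) :=
    (((integrable_comp_smul_iff volume g hR.ne').mpr hgi).const_mul _).const_mul _
  refine (norm_integral_le_of_norm_le hgR (Eventually.of_forall fun z => ?_)).trans ?_
  · rw [← mul_sub, ← mul_sub, norm_mul, norm_mul, norm_pow, norm_zpow, Complex.norm_ofNat,
      smul_sub, smul_sub]
    exact mul_le_mul_of_nonneg_right (hM z) (by positivity)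
  · rw [integral_const_mul, integral_const_mul, Measure.integral_comp_smul volume g]
    simp only [finrank_euclideanSpace, Fintype.card_fin, smul_eq_mul]
    rw [abs_of_pos (by positivity), mul_inv_cancel_left₀ (by positivity)]
    have h2 := hC ((2 : ℝ) ^ j • x) ((2 : ℝ) ^ j • y)
    rw [← smul_sub, norm_smul, Real.norm_of_nonneg hR.le] at h2
    exact (mul_le_mul_of_nonneg_left h2 hM0).trans (le_of_eq (by ring))

/-- The increments of a bounded continuous function are bounded by the sum of the increments of its
dyadic blocks. -/
theorem norm_sub_le_tsum_of_blocks (hφ : IsLPGenerator φ) (hw : Continuous w)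
    (hM : ∀ x, ‖w x‖ ≤ M) (x y : Rd d) {B : ℤ → ℝ} (hB : Summable B)
    (hblock : ∀ j, ‖(∫ z, w z * (ofFourier (lpSymbol φ j x) : 𝓢(Rd d, ℂ)) z)
      - ∫ z, w z * (ofFourier (lpSymbol φ j y) : 𝓢(Rd d, ℂ)) z‖ ≤ B j) :
    ‖w x - w y‖ ≤ ∑' j, B j := by
  have hB0 : ∀ j, 0 ≤ B j := fun j => (norm_nonneg _).trans (hblock j)
  obtain ⟨C, hC⟩ := exists_norm_lowPart_sub_le hφ hw hM
  set A : ℤ → ℂ := fun j => lowPart hφ w j x - lowPart hφ w j y with hA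
  have hstep : ∀ j, ‖A j - A (j - 1)‖ ≤ B j := by
    intro j
    have : A j - A (j - 1) = (lowPart hφ w j x - lowPart hφ w (j - 1) x)
        - (lowPart hφ w j y - lowPart hφ w (j - 1) y) := by
      simp only [hA]
      ring
    rw [this, lowPart_sub_lowPart hφ hw hM, lowPart_sub_lowPart hφ hw hM]
    exact hblock j
  -- Passing from scale `j` to scale `j + k` adds the blocks `j + 1, …, j + k`, whence the shift `i
  -- + 1`.
  have hsum : ∀ (j : ℤ) (k : ℕ), ‖A (j + k) - A j‖ ≤ ∑ i ∈ Finset.range k, B (j + (i + 1 : ℕ)) := by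
    intro j k
    induction k with
    | zero => simp
    | succ k ih =>
      rw [Finset.sum_range_succ]
      have h1 := hstep (j + (k + 1 : ℕ))
      have h2 : j + ((k + 1 : ℕ) : ℤ) - 1 = j + k := by
        push_cast
        ring
      rw [h2] at h1
      calc ‖A (j + (k + 1 : ℕ)) - A j‖
          = ‖(A (j + (k + 1 : ℕ)) - A (j + k)) + (A (j + k) - A j)‖ := by
            congr 1
            ring
        _ ≤ ‖A (j + (k + 1 : ℕ)) - A (j + k)‖ + ‖A (j + k) - A j‖ := norm_add_le _ _
        _ ≤ _ := by linarith
  -- Telescoping from `-n` to `n`: the lower end contributes a Lipschitz term of size `2^{-n}`,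
  -- while the upper end tends to the increment of `w`.
  have htot : ∀ n : ℕ, ‖A n‖ ≤ C * ((2 : ℝ) ^ (n : ℤ))⁻¹ * ‖x - y‖ + ∑' j, B j := by
    intro n
    have hinj : Function.Injective fun i : ℕ => -(n : ℤ) + ((i + 1 : ℕ) : ℤ) := fun a b h => by
      simpa using h
    have h1 := hsum (-(n : ℤ)) (n + n)
    have h2 : -(n : ℤ) + ((n + n : ℕ) : ℤ) = n := by
      push_cast
      ring
    rw [h2] at h1
    have h3 : ∑ i ∈ Finset.range (n + n), B (-(n : ℤ) + ((i + 1 : ℕ) : ℤ)) ≤ ∑' j, B j :=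
      ((hB.comp_injective hinj).sum_le_tsum _ fun i _ => hB0 _).trans
        (tsum_comp_le_tsum_of_inj hB hB0 hinj)
    have h4 := hC (-(n : ℤ)) x y
    rw [zpow_neg] at h4
    calc ‖A n‖ = ‖A (-(n : ℤ)) + (A n - A (-(n : ℤ)))‖ := by
          congr 1
          ring
      _ ≤ ‖A (-(n : ℤ))‖ + ‖A n - A (-(n : ℤ))‖ := norm_add_le _ _
      _ ≤ _ := add_le_add h4 (h1.trans h3)
  have hlim : Tendsto (fun n : ℕ => ‖A n‖) atTop (𝓝 ‖w x - w y‖) :=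
    ((tendsto_lowPart hφ hw hM x).sub (tendsto_lowPart hφ hw hM y)).norm
  have hlim2 : Tendsto (fun n : ℕ => C * ((2 : ℝ) ^ (n : ℤ))⁻¹ * ‖x - y‖ + ∑' j, B j) atTop
      (𝓝 (C * 0 * ‖x - y‖ + ∑' j, B j)) := by
    refine Tendsto.add_const _ (Tendsto.mul_const _ (Tendsto.const_mul C ?_))
    simp only [zpow_natCast]
    exact tendsto_inv_atTop_zero.comp (tendsto_pow_atTop_atTop_of_one_lt one_lt_two)
  have := le_of_tendsto_of_tendsto' hlim hlim2 htot
  simpa using this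

end LowPass

/-- The increments of a velocity are controlled by the increments of its localizations. -/
theorem IsVelocity.norm_apply_sub_le {φ : Rd 2 → ℝ} (hφ : IsLPGenerator φ) {T : DistDot 2}
    {v : Rd 2 → EuclideanSpace ℂ (Fin 2)} (hv : IsVelocity T v) (l : Fin 2) (x y : Rd 2)
    {B : ℤ → ℝ} (hB : Summable B)
    (hblock : ∀ j, ‖T (bsTest φ j l x) - T (bsTest φ j l y)‖ ≤ B j) :
    ‖v x l - v y l‖ ≤ ∑' j, B j := by
  obtain ⟨M, hM⟩ := hv.bounded
  -- The law is tested with the kernel of the `j`-th block; its image under the transposed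
  -- multiplier is exactly `bsTest`.
  have hlaw : ∀ j x, ∫ z, v z l * (ofFourier (lpSymbol φ j x) : 𝓢(Rd 2, ℂ)) z
      = T (bsTest φ j l x) := fun j x => by
    refine hv.law l (ofFourier (lpSymbol φ j x)) (bsTest φ j l x) fun ξ => ?_
    rw [hφ.fourier_bsTest, fourier_ofFourier (hφ.isAnnular_lpSymbol j x), lpSymbol_eq, bsMul]
    ring
  refine norm_sub_le_tsum_of_blocks hφ (w := fun x => v x l) (M := M) ?_ ?_ x y hB fun j => ?_
  · exact (continuous_apply l).comp ((PiLp.continuous_ofLp 2 _).comp hv.continuous)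
  · exact fun x => (PiLp.norm_apply_le (v x) l).trans (hM x)
  · rw [hlaw, hlaw]
    exact hblock j

/-! ### Growth functions -/

section Growth

variable {κ : ℝ} {Θ : ℝ → ℝ}

/-- Doubling means at most polynomial growth; enlarging the doubling constant to `2 ^ m` makes the
power explicit. -/
theorem IsGrowthFunction.exists_doubling_pow (hΘ : IsGrowthFunction κ Θ) :
    ∃ m : ℕ, ∀ (k : ℕ) (p : ℝ), 0 ≤ p → Θ (2 ^ k * p) ≤ (2 ^ k) ^ m * Θ p := by
  obtain ⟨c, hc⟩ := hΘ.doubling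
  obtain ⟨m, hm⟩ := pow_unbounded_of_one_lt c (one_lt_two (α := ℝ))
  refine ⟨m, fun k p hp => ?_⟩
  induction k with
  | zero => simp
  | succ k ih =>
    have hq : 0 ≤ 2 ^ k * p := by positivity
    calc Θ (2 ^ (k + 1) * p) = Θ (2 * (2 ^ k * p)) := by ring_nf
      _ ≤ c * Θ (2 ^ k * p) := hc _ hq
      _ ≤ 2 ^ m * Θ (2 ^ k * p) := mul_le_mul_of_nonneg_right hm.le (hΘ.pos _ hq).le
      _ ≤ 2 ^ m * ((2 ^ k) ^ m * Θ p) := by gcongr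
      _ = (2 ^ (k + 1)) ^ m * Θ p := by rw [pow_succ 2 k, mul_pow]; ring

theorem pow_le_factorial_mul_two_rpow (m : ℕ) {t : ℝ} (ht : 0 ≤ t) :
    t ^ m ≤ (m.factorial / Real.log 2 ^ m) * 2 ^ t := by
  have hl : 0 < Real.log 2 := Real.log_pos one_lt_two
  have h := Real.pow_div_factorial_le_exp (Real.log 2 * t) (by positivity) m
  rw [Real.rpow_def_of_pos two_pos, div_mul_eq_mul_div, le_div_iff₀ (by positivity)]
  rw [div_le_iff₀ (by positivity), mul_pow] at h
  linarith

/-- At dyadic arguments the Yudovich function dominates the growth function. -/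
theorem IsGrowthFunction.exists_le_yudovich (hΘ : IsGrowthFunction κ Θ) :
    ∃ K : ℝ, 0 < K ∧ ∀ (N : ℕ) (r : ℝ), (2 : ℝ) ^ N ≤ r → Θ N ≤ K * yudovich Θ r := by
  obtain ⟨m, hm⟩ := hΘ.exists_doubling_pow
  have hl : 0 < Real.log 2 := Real.log_pos one_lt_two
  set D : ℝ := 2 ^ m * (m.factorial / Real.log 2 ^ m) with hD
  have hD0 : 0 < D := by positivity
  refine ⟨1 + D, by positivity, fun N r hr => ?_⟩
  have hr1 : 1 ≤ r := (one_le_pow₀ one_le_two).trans hr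
  have : Nonempty (Set.Ioi (1 : ℝ)) := ⟨⟨2, Set.mem_Ioi.mpr one_lt_two⟩⟩
  rw [mul_comm, ← div_le_iff₀ (by positivity), yudovich]
  refine le_ciInf fun p => ?_
  obtain ⟨p, hp⟩ := p
  rw [Set.mem_Ioi] at hp
  have hp0 : 0 < p := by linarith
  have hΘp := hΘ.pos p hp0.le
  simp only
  rw [div_le_iff₀ (by positivity)]
  have hrp : 1 ≤ r ^ (1 / p) := Real.one_le_rpow hr1 (by positivity)
  -- For `p ≥ N` monotonicity is enough. For `p ≤ N` the doubling bound costs a power of `N / p`,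
  -- dominated by `2 ^ (N / p) ≤ r ^ (1 / p)` uniformly in `p`.
  rcases le_total (N : ℝ) p with hNp | hNp
  · calc Θ N ≤ Θ p := hΘ.mono _ _ (by positivity) hNp
      _ ≤ Θ p * r ^ (1 / p) := le_mul_of_one_le_right hΘp.le hrp
      _ ≤ _ := le_mul_of_one_le_right (by positivity) (by linarith)
  · have ht : 1 ≤ (N : ℝ) / p := (one_le_div hp0).mpr hNp
    obtain ⟨k, hk1, hk2⟩ := exists_nat_pow_near ht (one_lt_two (α := ℝ))
    have hN : (N : ℝ) ≤ 2 ^ (k + 1) * p := ((div_lt_iff₀ hp0).mp hk2).le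
    have h2 : (2 : ℝ) ^ ((N : ℝ) / p) ≤ r ^ (1 / p) := by
      rw [div_eq_mul_one_div, Real.rpow_mul zero_le_two, Real.rpow_natCast]
      exact Real.rpow_le_rpow (by positivity) hr (by positivity)
    calc Θ N ≤ Θ (2 ^ (k + 1) * p) := hΘ.mono _ _ (by positivity) hN
      _ ≤ (2 ^ (k + 1)) ^ m * Θ p := hm (k + 1) p hp0.le
      _ = 2 ^ m * (2 ^ k) ^ m * Θ p := by rw [pow_succ, mul_pow]; ring
      _ ≤ 2 ^ m * ((N : ℝ) / p) ^ m * Θ p := by gcongr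
      _ ≤ 2 ^ m * ((m.factorial / Real.log 2 ^ m) * r ^ (1 / p)) * Θ p := by
          have := (pow_le_factorial_mul_two_rpow m (by positivity : 0 ≤ (N : ℝ) / p)).trans
            (mul_le_mul_of_nonneg_left h2 (by positivity))
          gcongr
      _ = Θ p * r ^ (1 / p) * D := by ring
      _ ≤ _ := mul_le_mul_of_nonneg_left (by linarith) (by positivity)

/-- This serves separations `δ = 1/r ≥ 1`: it gives `Θ 1 ≤ δ * yudovich Θ (1 / δ)`, so a bound
uniform in `δ` is already good enough. -/
theorem IsGrowthFunction.mul_le_yudovich (hΘ : IsGrowthFunction κ Θ) {r : ℝ} (hr0 : 0 < r)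
    (hr1 : r ≤ 1) : Θ 1 * r ≤ yudovich Θ r := by
  have : Nonempty (Set.Ioi (1 : ℝ)) := ⟨⟨2, Set.mem_Ioi.mpr one_lt_two⟩⟩
  refine le_ciInf fun p => ?_
  obtain ⟨p, hp⟩ := p
  rw [Set.mem_Ioi] at hp
  have h1 : Θ 1 ≤ Θ p := hΘ.mono 1 p zero_le_one hp.le
  have h2 : r ≤ r ^ (1 / p) := by
    conv_lhs => rw [← Real.rpow_one r]
    exact Real.rpow_le_rpow_of_exponent_ge hr0 hr1 (by rw [div_le_one (by linarith)]; exact hp.le)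
  exact mul_le_mul h1 h2 hr0.le (hΘ.pos p (by linarith)).le

/-- Summation of the high frequencies. -/
theorem IsGrowthFunction.exists_sum_tail_le (hΘ : IsGrowthFunction 1 Θ) :
    ∃ c : ℝ, 0 ≤ c ∧ ∀ (N : ℕ) (S : Finset ℤ), (∀ j ∈ S, (N : ℤ) < j) →
      ∑ j ∈ S, ((2 : ℝ) ^ j)⁻¹ * Θ j ≤ c * (((2 : ℝ) ^ N)⁻¹ * Θ N) := by
  obtain ⟨c, hc⟩ := hΘ.tail
  have hrw : ∀ j : ℕ, (2 : ℝ) ^ (-((j : ℝ) * 1)) = ((2 : ℝ) ^ (j : ℤ))⁻¹ := fun j => by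
    rw [mul_one, Real.rpow_neg zero_le_two, Real.rpow_natCast, zpow_natCast]
  refine ⟨max c 0, le_max_right _ _, fun N S hS => ?_⟩
  let e : ℕ → ℤ := fun i => ((N + i : ℕ) : ℤ)
  have he : Function.Injective e := fun a b h => by
    simpa [e] using h
  have hsum := hΘ.summable
  simp only [hrw] at hsum hc
  have hsum' : Summable fun i : ℕ => ((2 : ℝ) ^ e i)⁻¹ * Θ (e i) := by
    refine (hsum.comp_injective (add_right_injective N)).congr fun i => ?_
    simp only [e, Function.comp_apply, Int.cast_natCast]
  have h1 : ∑ j ∈ S, ((2 : ℝ) ^ j)⁻¹ * Θ j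
      = ∑ i ∈ S.preimage e he.injOn, ((2 : ℝ) ^ e i)⁻¹ * Θ (e i) := by
    refine (Finset.sum_preimage e S he.injOn (fun j : ℤ => ((2 : ℝ) ^ j)⁻¹ * Θ j)
      fun j hj hne => ?_).symm
    refine absurd ⟨(j - N).toNat, ?_⟩ hne
    have := hS j hj
    simp only [e]
    push_cast
    omega
  rw [h1]
  refine (hsum'.sum_le_tsum _ fun i _ => ?_).trans ?_
  · have := hΘ.pos (e i) (by simp only [e]; positivity)
    positivity
  · have h2 := hc N
    have h3 : (∑' i : ℕ, ((2 : ℝ) ^ e i)⁻¹ * Θ (e i))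
        = ∑' j : ℕ, ((2 : ℝ) ^ ((N + j : ℕ) : ℤ))⁻¹ * Θ ((N + j : ℕ) : ℝ) := by
      simp only [e, Int.cast_natCast]
    rw [h3]
    refine h2.trans ?_
    rw [zpow_natCast]
    have := hΘ.pos N (by positivity)
    exact mul_le_mul_of_nonneg_right (le_max_left _ _) (by positivity)

/-- The interpolation between low and high frequencies behind the modulus of continuity. -/
theorem IsGrowthFunction.exists_tsum_min_le (hΘ : IsGrowthFunction 1 Θ) :
    ∃ K : ℝ, 0 < K ∧ ∀ (a : ℤ → ℝ) (M δ : ℝ), (∀ j, 0 ≤ a j) → 0 ≤ M → 0 < δ →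
      Summable (fun j : ℤ => ((2 : ℝ) ^ j)⁻¹ * a j) → ∑' j : ℤ, ((2 : ℝ) ^ j)⁻¹ * a j ≤ M →
      (∀ (N : ℕ) (S : Finset ℤ), (∀ j ∈ S, j ≤ (N : ℤ)) → ∑ j ∈ S, a j ≤ Θ N * M) →
      Summable (fun j : ℤ => min ((2 : ℝ) ^ j)⁻¹ δ * a j) ∧
      ∑' j : ℤ, min ((2 : ℝ) ^ j)⁻¹ δ * a j ≤ K * (δ * yudovich Θ (1 / δ)) * M := by
  obtain ⟨K, hK0, hK⟩ := hΘ.exists_le_yudovich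
  obtain ⟨c, hc0, hc⟩ := hΘ.exists_sum_tail_le
  have hΘ1 := hΘ.pos 1 zero_le_one
  refine ⟨(1 + 2 * c) * K + (Θ 1)⁻¹, by positivity, fun a M δ ha hM hδ hs hsM hlow => ?_⟩
  have hterm0 : ∀ j, 0 ≤ min ((2 : ℝ) ^ j)⁻¹ δ * a j := fun j => mul_nonneg (by positivity) (ha j)
  have hterm : ∀ j, min ((2 : ℝ) ^ j)⁻¹ δ * a j ≤ ((2 : ℝ) ^ j)⁻¹ * a j := fun j =>
    mul_le_mul_of_nonneg_right (min_le_left _ _) (ha j)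
  have hsm := Summable.of_nonneg_of_le hterm0 hterm hs
  refine ⟨hsm, ?_⟩
  rcases le_or_gt 1 δ with h1 | h1
  · have hy := hΘ.mul_le_yudovich (r := 1 / δ) (by positivity) ((div_le_one hδ).mpr h1)
    have hy' : 1 ≤ (Θ 1)⁻¹ * (δ * yudovich Θ (1 / δ)) := by
      have h2 : Θ 1 ≤ δ * yudovich Θ (1 / δ) := by
        calc Θ 1 = δ * (Θ 1 * (1 / δ)) := by field_simp
          _ ≤ _ := mul_le_mul_of_nonneg_left hy hδ.le
      rw [inv_mul_eq_div]
      exact (one_le_div hΘ1).mpr h2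
    have hy0 : 0 ≤ δ * yudovich Θ (1 / δ) :=
      mul_nonneg hδ.le (le_trans (by positivity) hy)
    calc ∑' j : ℤ, min ((2 : ℝ) ^ j)⁻¹ δ * a j ≤ ∑' j : ℤ, ((2 : ℝ) ^ j)⁻¹ * a j :=
          hsm.tsum_le_tsum hterm hs
      _ ≤ 1 * M := by rwa [one_mul]
      _ ≤ _ := by
        refine mul_le_mul_of_nonneg_right (hy'.trans ?_) hM
        exact mul_le_mul_of_nonneg_right (le_add_of_nonneg_left (by positivity)) hy0
  -- The cut between low and high frequencies is at `2^N ≤ 1/δ < 2^{N+1}`, where the two entries of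
  -- the minimum are comparable.
  · obtain ⟨N, hN1, hN2⟩ := exists_nat_pow_near ((one_le_div hδ).mpr h1.le)
      (one_lt_two (α := ℝ))
    have hΘN := hΘ.pos N (by positivity)
    have hδN : ((2 : ℝ) ^ N)⁻¹ ≤ 2 * δ := by
      rw [div_lt_iff₀ hδ, pow_succ] at hN2
      rw [inv_le_iff_one_le_mul₀ (by positivity)]
      linarith
    have hyN := hK N (1 / δ) hN1
    have hmain : ∑' j : ℤ, min ((2 : ℝ) ^ j)⁻¹ δ * a j ≤ (1 + 2 * c) * (δ * Θ N) * M := by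
      refine hsm.tsum_le_of_sum_le fun S => ?_
      rw [← Finset.sum_filter_add_sum_filter_not S (fun j => j ≤ (N : ℤ))]
      have hl : ∑ j ∈ S with j ≤ (N : ℤ), min ((2 : ℝ) ^ j)⁻¹ δ * a j ≤ δ * (Θ N * M) := by
        calc ∑ j ∈ S with j ≤ (N : ℤ), min ((2 : ℝ) ^ j)⁻¹ δ * a j
            ≤ ∑ j ∈ S with j ≤ (N : ℤ), δ * a j :=
              Finset.sum_le_sum fun j _ => mul_le_mul_of_nonneg_right (min_le_right _ _) (ha j)
          _ = δ * ∑ j ∈ S with j ≤ (N : ℤ), a j := by rw [Finset.mul_sum]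
          _ ≤ _ := mul_le_mul_of_nonneg_left
              (hlow N _ fun j hj => (Finset.mem_filter.mp hj).2) hδ.le
      have hh : ∑ j ∈ S with ¬ j ≤ (N : ℤ), min ((2 : ℝ) ^ j)⁻¹ δ * a j
          ≤ c * (2 * δ * Θ N) * M := by
        have hgt : ∀ j ∈ S.filter (fun j => ¬ j ≤ (N : ℤ)), (N : ℤ) < j := fun j hj =>
          not_le.mp (Finset.mem_filter.mp hj).2
        calc ∑ j ∈ S with ¬ j ≤ (N : ℤ), min ((2 : ℝ) ^ j)⁻¹ δ * a j
            ≤ ∑ j ∈ S with ¬ j ≤ (N : ℤ), ((2 : ℝ) ^ j)⁻¹ * Θ j * M := by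
              refine Finset.sum_le_sum fun j hj => (hterm j).trans ?_
              have hj0 : (0 : ℤ) ≤ j := (Int.natCast_nonneg N).trans (hgt j hj).le
              obtain ⟨n, rfl⟩ := Int.eq_ofNat_of_zero_le hj0
              -- A single block is bounded by the partial sum that ends with it, so `a n ≤ Θ n * M`
              -- and the tail condition on `Θ` applies.
              have := hlow n {(n : ℤ)} (by simp)
              rw [Finset.sum_singleton] at this
              rw [mul_assoc]
              exact mul_le_mul_of_nonneg_left this (by positivity)
          _ = (∑ j ∈ S with ¬ j ≤ (N : ℤ), ((2 : ℝ) ^ j)⁻¹ * Θ j) * M := by rw [Finset.sum_mul]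
          _ ≤ c * (((2 : ℝ) ^ N)⁻¹ * Θ N) * M :=
              mul_le_mul_of_nonneg_right (hc N _ hgt) hM
          _ ≤ _ := by gcongr
      calc _ ≤ δ * (Θ N * M) + c * (2 * δ * Θ N) * M := add_le_add hl hh
        _ = _ := by ring
    refine hmain.trans (mul_le_mul_of_nonneg_right ?_ hM)
    have hy0 : 0 ≤ yudovich Θ (1 / δ) :=
      (pos_of_mul_pos_right (hΘN.trans_le hyN) hK0.le).le
    calc (1 + 2 * c) * (δ * Θ N) ≤ (1 + 2 * c) * (δ * (K * yudovich Θ (1 / δ))) := by gcongr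
      _ = (1 + 2 * c) * K * (δ * yudovich Θ (1 / δ)) := by ring
      _ ≤ _ := mul_le_mul_of_nonneg_right (le_add_of_nonneg_right (by positivity)) (by positivity)

end Growth

/-! ### Besov and Vishik norms in terms of real series -/

section Norms

variable {φ : Rd d → ℝ}

theorem lpBlockNorm_ne_top_of_besovNorm (hφ : IsLPGenerator φ) {T : DistDot d} {s : ℝ}
    (h : besovNorm hφ s T < ⊤) (j : ℤ) : lpBlockNorm hφ j T ≠ ⊤ := by
  have h1 := ENNReal.ne_top_of_tsum_ne_top h.ne j
  intro htop
  rw [htop, ENNReal.mul_top (by simp; positivity)] at h1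
  exact h1 rfl

theorem hasSum_besovNorm (hφ : IsLPGenerator φ) {T : DistDot d}
    (h : besovNorm hφ (-1) T < ⊤) :
    HasSum (fun j : ℤ => ((2 : ℝ) ^ j)⁻¹ * blockNorm hφ T j) (besovNorm hφ (-1) T).toReal := by
  have h1 := ENNReal.hasSum_toReal (f := fun j : ℤ =>
    ENNReal.ofReal ((2 : ℝ) ^ ((j : ℝ) * (-1))) * lpBlockNorm hφ j T) h.ne
  rw [← ENNReal.tsum_toReal_eq (ENNReal.ne_top_of_tsum_ne_top h.ne)] at h1
  change HasSum _ (besovNorm hφ (-1) T).toReal at h1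
  refine h1.congr_fun fun j => ?_
  rw [ENNReal.toReal_mul, ENNReal.toReal_ofReal (by positivity), mul_neg_one,
    Real.rpow_neg zero_le_two, Real.rpow_intCast]
  rfl

theorem sum_blockNorm_le_vishikNorm (hφ : IsLPGenerator φ) {T : DistDot d} {Θ : ℝ → ℝ} {N : ℕ}
    (hΘ : 0 < Θ N) (hT : ∀ j, lpBlockNorm hφ j T ≠ ⊤) (h : vishikNorm hφ Θ 0 T < ⊤)
    {S : Finset ℤ} (hS : ∀ j ∈ S, j ≤ (N : ℤ)) :
    ∑ j ∈ S, blockNorm hφ T j ≤ Θ N * (vishikNorm hφ Θ 0 T).toReal := by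
  have h1 : ENNReal.ofReal ((Θ N)⁻¹) * ∑ j ∈ S, lpBlockNorm hφ j T ≤ vishikNorm hφ Θ 0 T := by
    refine le_trans ?_ (le_iSup (fun N : ℕ => ENNReal.ofReal ((Θ N)⁻¹) *
      ∑' j : Set.Iic (N : ℤ), ENNReal.ofReal ((2 : ℝ) ^ (((j : ℤ) : ℝ) * 0))
        * lpBlockNorm hφ j T) N)
    refine mul_le_mul_right ?_ _
    simp only [mul_zero, Real.rpow_zero, ENNReal.ofReal_one, one_mul]
    rw [← Finset.sum_subtype_of_mem (p := fun j => j ∈ Set.Iic (N : ℤ))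
      (fun j => lpBlockNorm hφ j T) hS]
    exact ENNReal.sum_le_tsum _
  have h2 := ENNReal.toReal_mono h.ne h1
  rw [ENNReal.toReal_mul, ENNReal.toReal_ofReal (by positivity),
    ENNReal.toReal_sum fun j _ => hT j, inv_mul_le_iff₀ hΘ] at h2
  exact h2

end Norms

/-! ### Neighbouring blocks and components -/

/-- Summation of a slowly varying weight against neighbouring blocks. -/
theorem summable_mul_sum_neighbours {w a : ℤ → ℝ} (hw : ∀ j, 0 ≤ w j) (ha : ∀ j, 0 ≤ a j)
    (hslow : ∀ j, ∀ i ∈ Finset.Icc (-1 : ℤ) 1, w j ≤ 2 * w (j + i))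
    (hs : Summable fun j => w j * a j) :
    (Summable fun j => w j * ∑ i ∈ Finset.Icc (-1 : ℤ) 1, a (j + i)) ∧
      ∑' j, w j * ∑ i ∈ Finset.Icc (-1 : ℤ) 1, a (j + i) ≤ 6 * ∑' j, w j * a j := by
  have hshift : ∀ i : ℤ, HasSum (fun j => w (j + i) * a (j + i)) (∑' j, w j * a j) := fun i =>
    (Equiv.addRight i).hasSum_iff.mpr hs.hasSum
  have hbig : HasSum (fun j => 2 * ∑ i ∈ Finset.Icc (-1 : ℤ) 1, w (j + i) * a (j + i))
      (2 * ∑ _i ∈ Finset.Icc (-1 : ℤ) 1, ∑' j, w j * a j) :=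
    (hasSum_sum fun i _ => hshift i).mul_left 2
  have hle : ∀ j, w j * ∑ i ∈ Finset.Icc (-1 : ℤ) 1, a (j + i)
      ≤ 2 * ∑ i ∈ Finset.Icc (-1 : ℤ) 1, w (j + i) * a (j + i) := by
    intro j
    rw [Finset.mul_sum, Finset.mul_sum]
    refine Finset.sum_le_sum fun i hi => ?_
    rw [← mul_assoc]
    exact mul_le_mul_of_nonneg_right (hslow j i hi) (ha _)
  have hs' := Summable.of_nonneg_of_le
    (fun j => mul_nonneg (hw j) (Finset.sum_nonneg fun i _ => ha _)) hle hbig.summable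
  refine ⟨hs', (hs'.tsum_le_tsum hle hbig.summable).trans (le_of_eq ?_)⟩
  have hcard : (Finset.Icc (-1 : ℤ) 1).card = 3 := rfl
  rw [hbig.tsum_eq, Finset.sum_const, hcard, nsmul_eq_mul]
  push_cast
  ring

theorem inv_two_zpow_le_two_mul (j : ℤ) {i : ℤ} (hi : i ∈ Finset.Icc (-1 : ℤ) 1) :
    ((2 : ℝ) ^ j)⁻¹ ≤ 2 * ((2 : ℝ) ^ (j + i))⁻¹ := by
  have h1 : (2 : ℝ) ^ (j + i) ≤ 2 ^ (j + 1) :=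
    zpow_le_zpow_right₀ one_le_two (by have := (Finset.mem_Icc.mp hi).2; omega)
  rw [zpow_add_one₀ two_ne_zero] at h1
  rw [← div_eq_mul_inv, le_div_iff₀ (by positivity), inv_mul_le_iff₀ (by positivity)]
  exact h1

theorem EuclideanSpace.norm_le_sum_fin_two (u : EuclideanSpace ℂ (Fin 2)) :
    ‖u‖ ≤ ‖u 0‖ + ‖u 1‖ := by
  rw [EuclideanSpace.norm_eq, Fin.sum_univ_two]
  refine Real.sqrt_le_iff.mpr ⟨by positivity, ?_⟩
  nlinarith [norm_nonneg (u 0), norm_nonneg (u 1),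
    mul_nonneg (norm_nonneg (u 0)) (norm_nonneg (u 1))]

end

/-! ### The modulus of continuity -/

theorem theorem1p5 {φ : Rd 2 → ℝ} (hφ : IsLPGenerator φ) (Θ : ℝ → ℝ)
    (hΘ : IsGrowthFunction 1 Θ) :
    ∃ C : ℝ, 0 < C ∧ ∀ ω : DistDot 2, vishikNorm hφ Θ 0 ω < ⊤ → besovNorm hφ (-1) ω < ⊤ →
      (∃ v : Rd 2 → EuclideanSpace ℂ (Fin 2), IsVelocity ω v ∧
        (ω.IsReal → ∀ x l, (v x l).im = 0)) ∧
      ∀ v : Rd 2 → EuclideanSpace ℂ (Fin 2), IsVelocity ω v → ∀ x y : Rd 2, x ≠ y →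
        ‖v x - v y‖ ≤ C * (‖x - y‖ * yudovich Θ (1 / ‖x - y‖)) *
          (max (vishikNorm hφ Θ 0 ω) (besovNorm hφ (-1) ω)).toReal := by
  obtain ⟨A, hA0, hA⟩ := hφ.exists_bsTest_bounds
  obtain ⟨K, hK0, hK⟩ := hΘ.exists_tsum_min_le
  -- The factor 24 is 2 (the block bounds at two points) times 6 (neighbouring blocks) times 2
  -- (components). The summand 1 keeps the constant positive when `A = 0`.
  refine ⟨24 * A * K + 1, by positivity, fun ω hV hB => ?_⟩
  have hT : ∀ j, lpBlockNorm hφ j ω ≠ ⊤ := lpBlockNorm_ne_top_of_besovNorm hφ hB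
  have hbes := hasSum_besovNorm hφ hB
  have ha : ∀ j, 0 ≤ blockNorm hφ ω j := blockNorm_nonneg hφ ω
  have hmax : max (vishikNorm hφ Θ 0 ω) (besovNorm hφ (-1) ω) ≠ ⊤ := (max_lt hV hB).ne
  set M := (max (vishikNorm hφ Θ 0 ω) (besovNorm hφ (-1) ω)).toReal with hM
  have hM0 : 0 ≤ M := ENNReal.toReal_nonneg
  have hVM : (vishikNorm hφ Θ 0 ω).toReal ≤ M := ENNReal.toReal_mono hmax (le_max_left _ _)
  have hBM : (besovNorm hφ (-1) ω).toReal ≤ M := ENNReal.toReal_mono hmax (le_max_right _ _)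
  refine ⟨hφ.exists_isVelocity hT (summable_mul_sum_neighbours (fun j => by positivity) ha
    (fun j i hi => inv_two_zpow_le_two_mul j hi) hbes.summable).1, fun v hv x y hxy => ?_⟩
  set δ := ‖x - y‖ with hδ
  have hδ0 : 0 < δ := norm_pos_iff.mpr (sub_ne_zero.mpr hxy)
  obtain ⟨hs, hsum⟩ := hK (blockNorm hφ ω) M δ ha hM0 hδ0 hbes.summable
    (hbes.tsum_eq.le.trans hBM) fun N S hS =>
      (sum_blockNorm_le_vishikNorm hφ (hΘ.pos N (by positivity)) hT hV hS).trans
        (mul_le_mul_of_nonneg_left hVM (hΘ.pos N (by positivity)).le)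
  -- Like `2^{-j}`, the weight `min (2^{-j}, δ)` changes by at most a factor 2 between neighbouring
  -- indices.
  obtain ⟨hs', hsum'⟩ := summable_mul_sum_neighbours (w := fun j : ℤ => min ((2 : ℝ) ^ j)⁻¹ δ)
    (fun j => by positivity) ha (fun j i hi => by
      rw [mul_min_of_nonneg _ _ zero_le_two]
      exact min_le_min (inv_two_zpow_le_two_mul j hi) (by linarith)) hs
  have hcomp : ∀ l, ‖v x l - v y l‖ ≤ 12 * A * K * (δ * yudovich Θ (1 / δ)) * M := by
    intro l
    refine (hv.norm_apply_sub_le hφ l x y (hs'.mul_left (2 * A)) fun j => ?_).trans ?_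
    · have hb : 0 ≤ ∑ i ∈ Finset.Icc (-1 : ℤ) 1, blockNorm hφ ω (j + i) :=
        Finset.sum_nonneg fun i _ => ha _
      obtain ⟨h1, h2⟩ := hA ω hT j l
      rw [← mul_assoc, mul_min_of_nonneg _ _ (by positivity), min_mul_of_nonneg _ _ hb]
      refine le_min ?_ ((h2 x y).trans ?_)
      · calc ‖ω (bsTest φ j l x) - ω (bsTest φ j l y)‖
            ≤ ‖ω (bsTest φ j l x)‖ + ‖ω (bsTest φ j l y)‖ := norm_sub_le _ _
          _ ≤ _ := (add_le_add (h1 x) (h1 y)).trans (le_of_eq (by ring))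
      · refine mul_le_mul_of_nonneg_right ?_ hb
        exact mul_le_mul_of_nonneg_right (by linarith) hδ0.le
    · rw [tsum_mul_left]
      calc 2 * A * ∑' j : ℤ, min ((2 : ℝ) ^ j)⁻¹ δ *
            ∑ i ∈ Finset.Icc (-1 : ℤ) 1, blockNorm hφ ω (j + i)
          ≤ 2 * A * (6 * (K * (δ * yudovich Θ (1 / δ)) * M)) := by
            refine mul_le_mul_of_nonneg_left (hsum'.trans ?_) (by positivity)
            exact mul_le_mul_of_nonneg_left hsum (by norm_num)
        _ = _ := by ring
  -- The sign is read off the upper bound for a nonnegative series; it allows the constant to be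
  -- enlarged by 1.
  have hnn : 0 ≤ δ * yudovich Θ (1 / δ) * M := by
    have h0 : 0 ≤ K * (δ * yudovich Θ (1 / δ)) * M :=
      (tsum_nonneg fun j => mul_nonneg (by positivity) (ha j)).trans hsum
    rw [mul_assoc] at h0
    exact nonneg_of_mul_nonneg_right h0 hK0
  calc ‖v x - v y‖ ≤ ‖v x 0 - v y 0‖ + ‖v x 1 - v y 1‖ := EuclideanSpace.norm_le_sum_fin_two _
    _ ≤ 24 * A * K * (δ * yudovich Θ (1 / δ)) * M := by linarith [hcomp 0, hcomp 1]
    _ ≤ _ := by linarith
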